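/- Let $a_1<a_2<a_3<a_4$ be real numbers, $P(x)=\prod_{i=1}^4(x-a_i)$, $\sigma=\frac14\sum_{i=1}^4 a_i$ and $L\psi=(P\psi')'+2(x-\sigma)^2\psi$. Write $[f,g]=f\,P\bar g'-\bar g\,Pf'$, $u(y)=1$ and $v(y)=\sum_{i=1}^4\big(\prod_{j\ne i}\frac1{a_i-a_j}\big)\ln|y-a_i|$. A function $\psi$ is said to satisfy the transmission conditions at $a_3$ if $[\psi,u](a_3^-)=[\psi,u](a_3^+)$ and $[\psi,v](a_3^-)=[\psi,v](a_3^+)$, where $[\cdot,\cdot](a_i^\pm)$ denote the one-sided limits, which are required to exist and be finite. Let $L_S$ be the operator $\psi\mapsto L\psi$ in the complex Hilbert space $L^2(a_2,a_4)$ with domain $D(L_S)$ consisting of all $\psi$ such that, on each of the intervals $I=(a_2,a_3)$ and $I=(a_3,a_4)$, $\psi$ and $P\psi'$ are locally absolutely continuous and $\psi,L\psi\in L^2(I)$, such that $[\psi,u](a_2^+)=[\psi,u](a_4^-)=0$, and such that $\psi$ satisfies the transmission conditions at $a_3$. A Green's function of $L_S-i$ is a function $G(x,\xi)$, $x,\xi\in(a_2,a_3)\cup(a_3,a_4)$,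 of the form $$G(x,\xi)=c_1(\xi)h_1(x)\ \text{ for } x\le\xi,\qquad G(x,\xi)=c_2(\xi)h_2(x)\ \text{ for } x\ge\xi,$$ where $h_1,h_2$ are solutions of $(L-i)h=0$ on $(a_2,a_3)\cup(a_3,a_4)$ that satisfy the transmission conditions at $a_3$; $h_1$ is bounded at $a_2^+$ and logarithmic at $a_3^\pm$ and $a_4^-$; $h_2$ is logarithmic at $a_2^+$ and $a_3^\pm$ and bounded at $a_4^-$; and $c_1,c_2$ satisfy, for every $\xi\in(a_2,a_3)\cup(a_3,a_4)$, $$c_1(\xi)h_1(\xi)-c_2(\xi)h_2(\xi)=0,\qquad c_1(\xi)h_1'(\xi)-c_2(\xi)h_2'(\xi)=-\frac1{P(\xi)}.$$ Here $h$ is called logarithmic at $c^\pm$ if, on that side of $c$ and near $c$, $h(x)=f(x)+g(x)\ln|x-c|$ with $f,g$ continuous at $c$ and $g(c)\neq0$. Lemma. A Green's function of $L_S-i$ exists, and every such $G$ is square-integrable on $(a_2,a_4)^2$. Moreover $L_S-i:D(L_S)\to L^2(a_2,a_4)$ is bijective, its inverse $(L_S-i)^{-1}:L^2(a_2,a_4)\to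 D(L_S)\subset L^2(a_2,a_4)$ is a compact operator on $L^2(a_2,a_4)$, and for every Green's function $G$ and every $f\in L^2(a_2,a_4)$ it is given by $\big((L_S-i)^{-1}f\big)(x)=\int_{a_2}^{a_4}G(x,\xi)f(\xi)\,d\xi$ for almost every $x\in(a_2,a_4)$. -/

import Mathlib

open MeasureTheory Filter Set Topology

noncomputable section

namespace TruncatedHilbert

/-! Throughout, the four points `a₁ < a₂ < a₃ < a₄` are `a 0 < a 1 < a 2 < a 3`. -/

/-- `P(x) = ∏ (x - aᵢ)`. -/
def P (a : Fin 4 → ℝ) (x : ℝ) : ℝ := ∏ i, (x - a i)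

/-- `σ = (1/4) ∑ aᵢ`. -/
def sigma (a : Fin 4 → ℝ) : ℝ := (1 / 4) * ∑ i, a i

/-- `P ψ'`. -/
def quasiDeriv (a : Fin 4 → ℝ) (ψ : ℝ → ℂ) (x : ℝ) : ℂ := (P a x : ℂ) * deriv ψ x

/-- The differential expression `L ψ = (P ψ')' + 2 (x - σ)² ψ`. -/
def L (a : Fin 4 → ℝ) (ψ : ℝ → ℂ) (x : ℝ) : ℂ :=
  deriv (quasiDeriv a ψ) x + 2 * ((x : ℂ) - (sigma a : ℂ)) ^ 2 * ψ x

/-- The Lagrange sesquilinear form `[f, g] = f P ḡ' - ḡ P f'`. -/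
def lagrange (a : Fin 4 → ℝ) (f g : ℝ → ℂ) (x : ℝ) : ℂ :=
  f x * quasiDeriv a (fun y => (starRingEnd ℂ) (g y)) x - (starRingEnd ℂ) (g x) * quasiDeriv a f x

/-- Absolute continuity on all compact subintervals of `s`. -/
def ACloc (f : ℝ → ℂ) (s : Set ℝ) : Prop :=
  ∀ c d : ℝ, uIcc c d ⊆ s → AbsolutelyContinuousOnInterval f c d

/-- The maximal domain of `L` on the open interval `(c, d)`. Differentiability at every point of
`(c, d)` is the meaning of `P ψ'` being a (continuous) function on `(c, d)`. -/
structure MaxDomainOn (a : Fin 4 → ℝ) (c d : ℝ) (ψ : ℝ → ℂ) : Prop where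
  ac : ACloc ψ (Ioo c d)
  diff : ∀ x ∈ Ioo c d, DifferentiableAt ℝ ψ x
  ac_quasi : ACloc (quasiDeriv a ψ) (Ioo c d)
  memLp : MemLp ψ 2 (volume.restrict (Ioo c d))
  memLp_L : MemLp (L a ψ) 2 (volume.restrict (Ioo c d))

/-- The maximal domain function `u = 1`. -/
def uFun : ℝ → ℂ := fun _ => 1

/-- The maximal domain function `v(y) = ∑ᵢ (∏_{j ≠ i} 1 / (aᵢ - aⱼ)) ln |y - aᵢ|`. -/
def vFun (a : Fin 4 → ℝ) : ℝ → ℂ := fun y =>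
  ((∑ i, (∏ j ∈ Finset.univ.erase i, 1 / (a i - a j)) * Real.log |y - a i| : ℝ) : ℂ)

/-- `[ψ, w](a₃⁻) = [ψ, w](a₃⁺)`: both one-sided limits exist and agree. -/
def Transmits (a : Fin 4 → ℝ) (ψ w : ℝ → ℂ) : Prop :=
  ∃ l : ℂ, Tendsto (lagrange a ψ w) (𝓝[<] a 2) (𝓝 l) ∧
    Tendsto (lagrange a ψ w) (𝓝[>] a 2) (𝓝 l)

/-- `ψ ∈ D(L_S)`, for a function `ψ` on `(a₂, a₃) ∪ (a₃, a₄)`. -/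
structure InDomainLS (a : Fin 4 → ℝ) (ψ : ℝ → ℂ) : Prop where
  left : MaxDomainOn a (a 1) (a 2) ψ
  right : MaxDomainOn a (a 2) (a 3) ψ
  bc_left : Tendsto (lagrange a ψ uFun) (𝓝[>] a 1) (𝓝 0)
  bc_right : Tendsto (lagrange a ψ uFun) (𝓝[<] a 3) (𝓝 0)
  trans_u : Transmits a ψ uFun
  trans_v : Transmits a ψ (vFun a)

/-- Lebesgue measure on `(a₂, a₄)`. -/
abbrev mu (a : Fin 4 → ℝ) : Measure ℝ := volume.restrict (Ioo (a 1) (a 3))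

/-- The complex Hilbert space `L²(a₂, a₄)`. -/
abbrev H (a : Fin 4 → ℝ) : Type := Lp ℂ 2 (mu a)

/-! ### Helper facts: `ψ ↦ L ψ` on `D(L_S)` is a well-defined linear operator in `L²(a₂, a₄)` -/

theorem ACloc.congr {f g : ℝ → ℂ} {s : Set ℝ} (hf : ACloc f s) (h : EqOn f g s) : ACloc g s := by
  intro c d hcd
  refine Tendsto.congr' ?_ (hf c d hcd)
  rw [EventuallyEq, eventually_inf_principal]
  refine Eventually.of_forall fun E hE => Finset.sum_congr rfl fun i hi => ?_
  rw [h (hcd (hE.1 i hi).1), h (hcd (hE.1 i hi).2)]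

theorem ACloc.add {f g : ℝ → ℂ} {s : Set ℝ} (hf : ACloc f s) (hg : ACloc g s) :
    ACloc (f + g) s := fun c d h => (hf c d h).add (hg c d h)

theorem ACloc.smul {f : ℝ → ℂ} {s : Set ℝ} (k : ℂ) (hf : ACloc f s) :
    ACloc (k • f) s := fun c d h => (hf c d h).const_smul k

theorem ACloc.ae_differentiableAt {f : ℝ → ℂ} {c d : ℝ} (hf : ACloc f (Ioo c d)) :
    ∀ᵐ x, x ∈ Ioo c d → DifferentiableAt ℝ f x := by
  have : LocallyBoundedVariationOn f (Ioo c d) := by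
    intro p q hp hq
    rcases le_total p q with hpq | hpq
    · refine (hf p q ?_).boundedVariationOn.mono ?_
      · exact (ordConnected_Ioo.uIcc_subset hp hq)
      · rw [uIcc_of_le hpq]; exact inter_subset_right
    · refine (hf p q ?_).boundedVariationOn.mono ?_
      · exact (ordConnected_Ioo.uIcc_subset hp hq)
      · intro x hx
        exact ⟨by simpa [hpq] using hx.2.1.trans' hpq, by simpa [hpq] using hx.2.2.trans hpq⟩
  filter_upwards [this.ae_differentiableWithinAt_of_mem] with x hx hxm
  exact (hx hxm).differentiableAt (isOpen_Ioo.mem_nhds hxm)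

theorem quasiDeriv_add {a : Fin 4 → ℝ} {f g : ℝ → ℂ} {x : ℝ} (hf : DifferentiableAt ℝ f x)
    (hg : DifferentiableAt ℝ g x) :
    quasiDeriv a (f + g) x = quasiDeriv a f x + quasiDeriv a g x := by
  simp only [quasiDeriv, deriv_add hf hg, mul_add]

theorem quasiDeriv_smul (a : Fin 4 → ℝ) (k : ℂ) (f : ℝ → ℂ) :
    quasiDeriv a (k • f) = k • quasiDeriv a f := by
  ext x
  simp only [quasiDeriv, deriv_const_smul_field, Pi.smul_apply, smul_eq_mul]
  ring

theorem L_smul (a : Fin 4 → ℝ) (k : ℂ) (f : ℝ → ℂ) : L a (k • f) = k • L a f := by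
  ext x
  simp only [L, quasiDeriv_smul, deriv_const_smul_field, Pi.smul_apply, smul_eq_mul]
  ring

theorem lagrange_smul (a : Fin 4 → ℝ) (k : ℂ) (f w : ℝ → ℂ) :
    lagrange a (k • f) w = k • lagrange a f w := by
  ext x
  simp only [lagrange, quasiDeriv_smul, Pi.smul_apply, smul_eq_mul]
  ring

theorem lagrange_add {a : Fin 4 → ℝ} {f g : ℝ → ℂ} (w : ℝ → ℂ) {x : ℝ}
    (hf : DifferentiableAt ℝ f x) (hg : DifferentiableAt ℝ g x) :
    lagrange a (f + g) w x = lagrange a f w x + lagrange a g w x := by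
  simp only [lagrange, quasiDeriv_add hf hg, Pi.add_apply]
  ring

theorem MaxDomainOn.L_add {a : Fin 4 → ℝ} {c d : ℝ} {f g : ℝ → ℂ} (hf : MaxDomainOn a c d f)
    (hg : MaxDomainOn a c d g) : ∀ᵐ x, x ∈ Ioo c d → L a (f + g) x = L a f x + L a g x := by
  filter_upwards [hf.ac_quasi.ae_differentiableAt, hg.ac_quasi.ae_differentiableAt] with x h1 h2 hx
  have : quasiDeriv a (f + g) =ᶠ[𝓝 x] quasiDeriv a f + quasiDeriv a g := by
    filter_upwards [isOpen_Ioo.mem_nhds hx] with y hy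
    exact quasiDeriv_add (hf.diff y hy) (hg.diff y hy)
  simp only [L, this.deriv_eq, deriv_add (h1 hx) (h2 hx), Pi.add_apply]
  ring

theorem MaxDomainOn.add {a : Fin 4 → ℝ} {c d : ℝ} {f g : ℝ → ℂ} (hf : MaxDomainOn a c d f)
    (hg : MaxDomainOn a c d g) : MaxDomainOn a c d (f + g) where
  ac := hf.ac.add hg.ac
  diff x hx := (hf.diff x hx).add (hg.diff x hx)
  ac_quasi := (hf.ac_quasi.add hg.ac_quasi).congr fun x hx =>
    (quasiDeriv_add (hf.diff x hx) (hg.diff x hx)).symm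
  memLp := hf.memLp.add hg.memLp
  memLp_L := (hf.memLp_L.add hg.memLp_L).ae_eq <| by
    rw [EventuallyEq, ae_restrict_iff' measurableSet_Ioo]
    filter_upwards [hf.L_add hg] with x hx hxm
    exact (hx hxm).symm

theorem MaxDomainOn.smul {a : Fin 4 → ℝ} {c d : ℝ} {f : ℝ → ℂ} (k : ℂ)
    (hf : MaxDomainOn a c d f) : MaxDomainOn a c d (k • f) where
  ac := hf.ac.smul k
  diff x hx := (hf.diff x hx).const_smul k
  ac_quasi := by rw [quasiDeriv_smul]; exact hf.ac_quasi.smul k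
  memLp := hf.memLp.const_smul k
  memLp_L := by rw [L_smul]; exact hf.memLp_L.const_smul k

theorem tendsto_lagrange_add {a : Fin 4 → ℝ} {c d : ℝ} {f g w : ℝ → ℂ} {F : Filter ℝ} {l m : ℂ}
    (hf : MaxDomainOn a c d f) (hg : MaxDomainOn a c d g) (hF : Ioo c d ∈ F)
    (h1 : Tendsto (lagrange a f w) F (𝓝 l)) (h2 : Tendsto (lagrange a g w) F (𝓝 m)) :
    Tendsto (lagrange a (f + g) w) F (𝓝 (l + m)) := by
  refine (h1.add h2).congr' ?_
  filter_upwards [hF] with x hx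
  exact (lagrange_add w (hf.diff x hx) (hg.diff x hx)).symm

theorem InDomainLS.add {a : Fin 4 → ℝ} (ha : StrictMono a) {f g : ℝ → ℂ} (hf : InDomainLS a f)
    (hg : InDomainLS a g) : InDomainLS a (f + g) := by
  have h12 : a 1 < a 2 := ha (by decide)
  have h23 : a 2 < a 3 := ha (by decide)
  have key : ∀ w, Transmits a f w → Transmits a g w → Transmits a (f + g) w := by
    rintro w ⟨l, h1, h2⟩ ⟨m, h3, h4⟩
    exact ⟨l + m, tendsto_lagrange_add hf.left hg.left (Ioo_mem_nhdsLT h12) h1 h3,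
      tendsto_lagrange_add hf.right hg.right (Ioo_mem_nhdsGT h23) h2 h4⟩
  exact
    { left := hf.left.add hg.left
      right := hf.right.add hg.right
      bc_left := by
        simpa using tendsto_lagrange_add hf.left hg.left (Ioo_mem_nhdsGT h12) hf.bc_left hg.bc_left
      bc_right := by
        simpa using
          tendsto_lagrange_add hf.right hg.right (Ioo_mem_nhdsLT h23) hf.bc_right hg.bc_right
      trans_u := key _ hf.trans_u hg.trans_u
      trans_v := key _ hf.trans_v hg.trans_v }

theorem InDomainLS.smul {a : Fin 4 → ℝ} {f : ℝ → ℂ} (k : ℂ) (hf : InDomainLS a f) :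
    InDomainLS a (k • f) := by
  have key : ∀ w, Transmits a f w → Transmits a (k • f) w := by
    rintro w ⟨l, h1, h2⟩
    exact ⟨k • l, by rw [lagrange_smul]; exact h1.const_smul k,
      by rw [lagrange_smul]; exact h2.const_smul k⟩
  exact
    { left := hf.left.smul k
      right := hf.right.smul k
      bc_left := by rw [lagrange_smul, ← smul_zero k]; exact hf.bc_left.const_smul k
      bc_right := by rw [lagrange_smul, ← smul_zero k]; exact hf.bc_right.const_smul k
      trans_u := key _ hf.trans_u
      trans_v := key _ hf.trans_v }

theorem quasiDeriv_zero (a : Fin 4 → ℝ) : quasiDeriv a 0 = 0 := by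
  ext x; simp [quasiDeriv]

theorem L_zero (a : Fin 4 → ℝ) : L a 0 = 0 := by
  ext x; simp [L, quasiDeriv_zero]

theorem lagrange_zero (a : Fin 4 → ℝ) (w : ℝ → ℂ) : lagrange a 0 w = 0 := by
  ext x; simp [lagrange, quasiDeriv_zero]

theorem ACloc_zero (s : Set ℝ) : ACloc 0 s := fun c d _ => by
  simpa [AbsolutelyContinuousOnInterval] using tendsto_const_nhds

theorem MaxDomainOn_zero (a : Fin 4 → ℝ) (c d : ℝ) : MaxDomainOn a c d 0 where
  ac := ACloc_zero _
  diff _ _ := differentiableAt_const _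
  ac_quasi := by rw [quasiDeriv_zero]; exact ACloc_zero _
  memLp := MemLp.zero
  memLp_L := by rw [L_zero]; exact MemLp.zero

theorem InDomainLS_zero (a : Fin 4 → ℝ) : InDomainLS a 0 where
  left := MaxDomainOn_zero _ _ _
  right := MaxDomainOn_zero _ _ _
  bc_left := by rw [lagrange_zero]; exact tendsto_const_nhds
  bc_right := by rw [lagrange_zero]; exact tendsto_const_nhds
  trans_u := ⟨0, by rw [lagrange_zero]; exact ⟨tendsto_const_nhds, tendsto_const_nhds⟩⟩
  trans_v := ⟨0, by rw [lagrange_zero]; exact ⟨tendsto_const_nhds, tendsto_const_nhds⟩⟩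

/-- Up to a null set, `(a₂, a₄)` is `(a₂, a₃) ∪ (a₃, a₄)`. -/
theorem ae_mu_of {a : Fin 4 → ℝ} {p : ℝ → Prop} (h1 : ∀ᵐ x, x ∈ Ioo (a 1) (a 2) → p x)
    (h2 : ∀ᵐ x, x ∈ Ioo (a 2) (a 3) → p x) : ∀ᵐ x ∂(mu a), p x := by
  rw [ae_restrict_iff' measurableSet_Ioo]
  have h3 : ∀ᵐ x : ℝ, x ≠ a 2 := by simp [ae_iff, measure_singleton]
  filter_upwards [h1, h2, h3] with x k1 k2 k3 hx
  rcases lt_or_gt_of_ne k3 with h | h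
  · exact k1 ⟨hx.1, h⟩
  · exact k2 ⟨h, hx.2⟩

theorem InDomainLS.L_add {a : Fin 4 → ℝ} {f g : ℝ → ℂ} (hf : InDomainLS a f)
    (hg : InDomainLS a g) : L a (f + g) =ᵐ[mu a] L a f + L a g :=
  ae_mu_of (hf.left.L_add hg.left) (hf.right.L_add hg.right)

/-- The graph `{(ψ, L ψ) : ψ ∈ D(L_S)}` in `L²(a₂, a₄) × L²(a₂, a₄)`. -/
def graphLS (a : Fin 4 → ℝ) (ha : StrictMono a) : Submodule ℂ (H a × H a) where
  carrier := {p | ∃ ψ : ℝ → ℂ, InDomainLS a ψ ∧ p.1 =ᵐ[mu a] ψ ∧ p.2 =ᵐ[mu a] L a ψ}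
  zero_mem' := ⟨0, InDomainLS_zero a, Lp.coeFn_zero _ _ _,
    by rw [L_zero]; exact Lp.coeFn_zero _ _ _⟩
  add_mem' := by
    rintro p q ⟨f, hf, hf1, hf2⟩ ⟨g, hg, hg1, hg2⟩
    exact ⟨f + g, hf.add ha hg, (Lp.coeFn_add _ _).trans (hf1.add hg1),
      (Lp.coeFn_add _ _).trans ((hf2.add hg2).trans (hf.L_add hg).symm)⟩
  smul_mem' := by
    rintro k p ⟨f, hf, hf1, hf2⟩
    exact ⟨k • f, hf.smul k, (Lp.coeFn_smul _ _).trans (hf1.const_smul k),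
      by rw [L_smul]; exact (Lp.coeFn_smul _ _).trans (hf2.const_smul k)⟩

theorem MaxDomainOn.L_eq_zero {a : Fin 4 → ℝ} {c d : ℝ} {f : ℝ → ℂ} (hf : MaxDomainOn a c d f)
    (h : f =ᵐ[volume.restrict (Ioo c d)] 0) : ∀ x ∈ Ioo c d, L a f x = 0 := by
  have hc : ContinuousOn f (Ioo c d) :=
    fun x hx => (hf.diff x hx).continuousAt.continuousWithinAt
  have h0 : EqOn f 0 (Ioo c d) :=
    Measure.eqOn_open_of_ae_eq h isOpen_Ioo hc continuousOn_const
  have h1 : EqOn (quasiDeriv a f) 0 (Ioo c d) := fun x hx => by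
    have : f =ᶠ[𝓝 x] 0 := h0.eventuallyEq_of_mem (isOpen_Ioo.mem_nhds hx)
    simp [quasiDeriv, this.deriv_eq]
  intro x hx
  have : quasiDeriv a f =ᶠ[𝓝 x] 0 := h1.eventuallyEq_of_mem (isOpen_Ioo.mem_nhds hx)
  simp [L, this.deriv_eq, h0 hx]

theorem graphLS_snd_eq_zero (a : Fin 4 → ℝ) (ha : StrictMono a) (x : H a × H a)
    (hx : x ∈ graphLS a ha) (hx' : x.fst = 0) : x.snd = 0 := by
  obtain ⟨f, hf, hf1, hf2⟩ := hx
  have h0 : f =ᵐ[mu a] 0 := by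
    rw [hx'] at hf1
    exact hf1.symm.trans (Lp.coeFn_zero _ _ _)
  have h12 : a 1 < a 2 := ha (by decide)
  have h23 : a 2 < a 3 := ha (by decide)
  have hl := hf.left.L_eq_zero
    (ae_restrict_of_ae_restrict_of_subset (Ioo_subset_Ioo_right h23.le) h0)
  have hr := hf.right.L_eq_zero
    (ae_restrict_of_ae_restrict_of_subset (Ioo_subset_Ioo_left h12.le) h0)
  rw [Lp.eq_zero_iff_ae_eq_zero]
  exact hf2.trans (ae_mu_of (Eventually.of_forall hl) (Eventually.of_forall hr))

/-! ### The operator `L_S` and its resolvent -/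

/-- The operator `L_S : D(L_S) → L²(a₂, a₄)`, `ψ ↦ L ψ`. -/
def LS (a : Fin 4 → ℝ) (ha : StrictMono a) : H a →ₗ.[ℂ] H a := (graphLS a ha).toLinearPMap

/-- The graph of `L_S` is what it should be. -/
theorem mem_graph_LS {a : Fin 4 → ℝ} {ha : StrictMono a} {f g : H a} :
    (f, g) ∈ (LS a ha).graph ↔
      ∃ ψ : ℝ → ℂ, InDomainLS a ψ ∧ f =ᵐ[mu a] ψ ∧ g =ᵐ[mu a] L a ψ := by
  rw [LS, Submodule.toLinearPMap_graph_eq _ (graphLS_snd_eq_zero a ha)]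
  rfl

/-- `R` is the everywhere defined bounded inverse `(A - z)⁻¹` of `A - z : D(A) → E`: it maps `E`
into `D(A)` and is a two-sided inverse of `A - z`. -/
def IsResolventAt {E : Type*} [NormedAddCommGroup E] [NormedSpace ℂ E] (A : E →ₗ.[ℂ] E) (z : ℂ)
    (R : E →L[ℂ] E) : Prop :=
  (∀ f : E, ∃ hf : R f ∈ A.domain, A ⟨R f, hf⟩ - z • R f = f) ∧
    ∀ ψ : A.domain, R (A ψ - z • (ψ : E)) = ψ

/-! ### The Green's function -/

/-- The domain `(a₂, a₃) ∪ (a₃, a₄)`. -/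
def twoIntervals (a : Fin 4 → ℝ) : Set ℝ := Ioo (a 1) (a 2) ∪ Ioo (a 2) (a 3)

/-- `h` is a (classical) solution of `(L - z) h = 0` on `(a₂, a₃) ∪ (a₃, a₄)`. -/
def IsSolution (a : Fin 4 → ℝ) (z : ℂ) (h : ℝ → ℂ) : Prop :=
  ∀ x ∈ twoIntervals a, DifferentiableAt ℝ h x ∧ DifferentiableAt ℝ (quasiDeriv a h) x ∧
    L a h x = z * h x

/-- `h` is bounded along the one-sided neighbourhood filter `F` of a point. -/
def BoundedAlong (F : Filter ℝ) (h : ℝ → ℂ) : Prop := ∃ C : ℝ, ∀ᶠ x in F, ‖h x‖ ≤ C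

/-- `h` has a logarithmic singularity at `c` along the one-sided neighbourhood filter `F` of `c`:
`h(x) = h₁(x) + h₂(x) ln |x - c|` near `c` with `h₁, h₂` continuous at `c` and `h₂(c) ≠ 0`. -/
def LogarithmicAlong (F : Filter ℝ) (c : ℝ) (h : ℝ → ℂ) : Prop :=
  ∃ h₁ h₂ : ℝ → ℂ, ContinuousAt h₁ c ∧ ContinuousAt h₂ c ∧ h₂ c ≠ 0 ∧
    ∀ᶠ x in F, h x = h₁ x + h₂ x * (Real.log |x - c| : ℂ)

/-- `G` is the Green's function of `L_S - z`, on `((a₂, a₃) ∪ (a₃, a₄))²`: it is built from two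
solutions `h₁, h₂` of `(L - z) h = 0` that satisfy the transmission conditions at `a₃` and are of
bounded-ln-ln type and of ln-ln-bounded type at `a₂, a₃, a₄`, and `G(·, ξ)` is continuous at `ξ`
with `∂G/∂x` jumping by `1 / P(ξ)` there. -/
def IsGreenFunction (a : Fin 4 → ℝ) (z : ℂ) (G : ℝ → ℝ → ℂ) : Prop :=
  ∃ h₁ h₂ c₁ c₂ : ℝ → ℂ,
    (IsSolution a z h₁ ∧ Transmits a h₁ uFun ∧ Transmits a h₁ (vFun a) ∧
      BoundedAlong (𝓝[>] a 1) h₁ ∧ LogarithmicAlong (𝓝[<] a 2) (a 2) h₁ ∧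
      LogarithmicAlong (𝓝[>] a 2) (a 2) h₁ ∧ LogarithmicAlong (𝓝[<] a 3) (a 3) h₁) ∧
    (IsSolution a z h₂ ∧ Transmits a h₂ uFun ∧ Transmits a h₂ (vFun a) ∧
      LogarithmicAlong (𝓝[>] a 1) (a 1) h₂ ∧ LogarithmicAlong (𝓝[<] a 2) (a 2) h₂ ∧
      LogarithmicAlong (𝓝[>] a 2) (a 2) h₂ ∧ BoundedAlong (𝓝[<] a 3) h₂) ∧
    (∀ ξ ∈ twoIntervals a, c₁ ξ * h₁ ξ - c₂ ξ * h₂ ξ = 0 ∧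
      c₁ ξ * deriv h₁ ξ - c₂ ξ * deriv h₂ ξ = -(1 / (P a ξ : ℂ))) ∧
    ∀ x ∈ twoIntervals a, ∀ ξ ∈ twoIntervals a,
      (x ≤ ξ → G x ξ = c₁ ξ * h₁ x) ∧ (ξ ≤ x → G x ξ = c₂ ξ * h₂ x)

end TruncatedHilbert

end

/-! The function `v` satisfies `P v' = 1`, by the partial fraction expansion of `1/P`. For a
function `h` put `B = P h'` and `A = h - v B`; then `[h,u] = -B` and `[h,v] = A`. With `q = z -
2(x-σ)²`, the equation `(L - z)h = 0` becomes the system `A' = -v q (A + v B)`, `B' = q (A + v B)`.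
Since `v` has only logarithmic singularities, `v` and `v²` are integrable on `(a₂,a₄)`, so this
system is regular up to the endpoints and across `a₃`. The transmission conditions say exactly that
`A` and `B` are continuous at `a₃`, and the boundary conditions that `B` vanishes at `a₂` and `a₄`.
The singular problem thus becomes a regular one on `[a₂,a₄]`: solutions exist for arbitrary data at
`a₂` (`exists_solutionData`), and the Wronskian `A₁B₂ - A₂B₁` is one constant on both intervals
(`wronskian_eq`).

For `z = i`, `Im(A B̄)` is continuous on `[a₂,a₄]` with derivative `-|h|²` away from `a₃`. It
vanishes wherever `B` does, so a solution with `B = 0` at two points vanishes between them. This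
gives injectivity of `L_S - i` (`InDomainLS.eq_zero`). It also shows that a nontrivial solution with
`B(a₂) = 0` has `B ≠ 0` at `a₃` and `a₄`, that is, genuine logarithms there; likewise from the right
end. Conversely `B = 0` at an end makes `h` bounded there. Two such solutions give a Green's
function (`exists_isGreenFunction`).

For an arbitrary Green's function the jump conditions force `c₁ = h₂/W` and `c₂ = h₁/W`, with `W ≠
0` the Wronskian (`IsGreenFunction.exists_greenData`). The kernel is then built from products of
square-integrable functions. Variation of parameters makes the integral operator a right inverse of
`L_S - i` (`inDomainLS_green`), and injectivity makes it two-sided. It is compact because it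
combines operators that take a primitive, compactly from `L²` to `C`, and then multiply by an `L²`
function. -/

noncomputable section

namespace TruncatedHilbert

/-! ### The function `v`: derivative, singularities, square-integrability. -/

/-- The coefficient `∏_{j ≠ i} 1 / (aᵢ - aⱼ)` of `ln |y - aᵢ|` in `v`. -/
def vCoeff (a : Fin 4 → ℝ) (i : Fin 4) : ℝ := ∏ j ∈ Finset.univ.erase i, 1 / (a i - a j)

/-- The real function underlying `vFun`. -/
def vReal (a : Fin 4 → ℝ) (y : ℝ) : ℝ := ∑ i, vCoeff a i * Real.log |y - a i|

theorem vFun_eq (a : Fin 4 → ℝ) (y : ℝ) : vFun a y = (vReal a y : ℂ) := rfl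

theorem vCoeff_eq (a : Fin 4 → ℝ) (i : Fin 4) :
    vCoeff a i = Lagrange.nodalWeight Finset.univ a i := by
  simp [vCoeff, Lagrange.nodalWeight]

theorem vCoeff_ne_zero {a : Fin 4 → ℝ} (ha : StrictMono a) (i : Fin 4) : vCoeff a i ≠ 0 := by
  rw [vCoeff_eq]
  exact Lagrange.nodalWeight_ne_zero ha.injective.injOn (Finset.mem_univ i)

/-- The barycentric form of Lagrange interpolation of the constant 1 at the nodes `aᵢ`. It yields `P
v' = 1`, on which the whole reduction rests. -/
theorem sum_vCoeff_div {a : Fin 4 → ℝ} (ha : StrictMono a) {x : ℝ} (hx : ∀ i, x ≠ a i) :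
    ∑ i, vCoeff a i * (x - a i)⁻¹ = 1 / P a x := by
  have h := Lagrange.eval_interpolate_not_at_node (s := Finset.univ) (v := a) (fun _ => (1 : ℝ))
    (fun i _ => hx i)
  have h1 : Lagrange.interpolate Finset.univ a (fun _ => (1 : ℝ)) = 1 := by
    rw [Lagrange.interpolate_apply]
    simpa using Lagrange.sum_basis ha.injective.injOn Finset.univ_nonempty
  rw [h1, Lagrange.eval_nodal] at h
  have hP : P a x ≠ 0 := Finset.prod_ne_zero_iff.2 fun i _ => sub_ne_zero.2 (hx i)
  simp only [Polynomial.eval_one, mul_one] at h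
  rw [eq_div_iff hP, mul_comm]
  simp only [vCoeff_eq]
  exact h.symm

theorem P_ne_zero {a : Fin 4 → ℝ} {x : ℝ} (hx : ∀ i, x ≠ a i) : P a x ≠ 0 :=
  Finset.prod_ne_zero_iff.2 fun i _ => sub_ne_zero.2 (hx i)

theorem hasDerivAt_vReal {a : Fin 4 → ℝ} (ha : StrictMono a) {x : ℝ} (hx : ∀ i, x ≠ a i) :
    HasDerivAt (vReal a) (1 / P a x) x := by
  rw [← sum_vCoeff_div ha hx]
  refine HasDerivAt.fun_sum fun i _ => ?_
  have h := ((hasDerivAt_id x).sub_const (a i)).log (sub_ne_zero.2 (hx i))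
  simp only [Real.log_abs]
  simpa [one_div] using h.const_mul (vCoeff a i)

theorem hasDerivAt_vFun {a : Fin 4 → ℝ} (ha : StrictMono a) {x : ℝ} (hx : ∀ i, x ≠ a i) :
    HasDerivAt (vFun a) (1 / (P a x : ℂ)) x := by
  have h := (hasDerivAt_vReal ha hx).ofReal_comp
  rw [Complex.ofReal_div, Complex.ofReal_one] at h
  exact h

theorem exists_vReal_split {a : Fin 4 → ℝ} (ha : StrictMono a) (i : Fin 4) :
    ∃ S : ℝ → ℝ, ContinuousAt S (a i) ∧
      ∀ x, vReal a x = S x + vCoeff a i * Real.log |x - a i| := by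
  refine ⟨fun x => ∑ j ∈ Finset.univ.erase i, vCoeff a j * Real.log |x - a j|, ?_, fun x => ?_⟩
  · refine tendsto_finsetSum _ fun j hj => ?_
    have hne : a i - a j ≠ 0 := sub_ne_zero.2 (ha.injective.ne (Finset.ne_of_mem_erase hj).symm)
    refine Tendsto.const_mul _ (ContinuousAt.log ?_ (abs_ne_zero.2 hne))
    fun_prop
  · rw [Finset.sum_erase_add _ _ (Finset.mem_univ i)]; rfl

theorem tendsto_abs_sub_nhdsGT (c : ℝ) : Tendsto (fun x : ℝ => |x - c|) (𝓝[≠] c) (𝓝[>] 0) := by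
  refine tendsto_nhdsWithin_iff.2 ⟨?_, ?_⟩
  · have : ContinuousAt (fun x : ℝ => |x - c|) c := by fun_prop
    simpa [ContinuousAt] using this.tendsto.mono_left (nhdsWithin_le_nhds (s := {c}ᶜ))
  · filter_upwards [self_mem_nhdsWithin] with x hx
    exact abs_pos.2 (sub_ne_zero.2 hx)

/-- A logarithm is beaten by any positive power. The exponent 1/2 is a convenient choice for the
later estimate that `v B` stays bounded where `B` vanishes. -/
theorem tendsto_vReal_mul_sqrt {a : Fin 4 → ℝ} (ha : StrictMono a) (i : Fin 4) :
    Tendsto (fun x => vReal a x * √|x - a i|) (𝓝[≠] (a i)) (𝓝 0) := by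
  obtain ⟨S, hS, hv⟩ := exists_vReal_split ha i
  have h1 : Tendsto (fun x : ℝ => √|x - a i|) (𝓝[≠] (a i)) (𝓝 0) := by
    have : ContinuousAt (fun x : ℝ => √|x - a i|) (a i) := by fun_prop
    simpa [ContinuousAt] using this.tendsto.mono_left nhdsWithin_le_nhds
  have h2 : Tendsto (fun x : ℝ => Real.log |x - a i| * √|x - a i|) (𝓝[≠] (a i)) (𝓝 0) := by
    simpa [Function.comp_def, Real.sqrt_eq_rpow] using
      (tendsto_log_mul_rpow_nhdsGT_zero (r := 1 / 2) (by norm_num)).comp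
        (tendsto_abs_sub_nhdsGT (a i))
  have h3 := ((hS.tendsto.mono_left nhdsWithin_le_nhds).mul h1).add (h2.const_mul (vCoeff a i))
  simp only [mul_zero, add_zero] at h3
  refine h3.congr fun x => ?_
  rw [hv]; ring

theorem tendsto_abs_vReal {a : Fin 4 → ℝ} (ha : StrictMono a) (i : Fin 4) :
    Tendsto (fun x => |vReal a x|) (𝓝[≠] (a i)) atTop := by
  obtain ⟨S, hS, hv⟩ := exists_vReal_split ha i
  have h1 : Tendsto (fun x : ℝ => |vCoeff a i * Real.log (|x - a i|)|) (𝓝[≠] (a i)) atTop := by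
    simp only [abs_mul]
    exact (tendsto_abs_atBot_atTop.comp
      (Real.tendsto_log_nhdsGT_zero.comp (tendsto_abs_sub_nhdsGT (a i)))).const_mul_atTop
        (abs_pos.2 (vCoeff_ne_zero ha i))
  have h2 := (hS.abs.neg.tendsto.mono_left nhdsWithin_le_nhds).add_atTop h1
  refine tendsto_atTop_mono (fun x => ?_) h2
  rw [hv]
  have := abs_add_le (S x + vCoeff a i * Real.log |x - a i|) (-S x)
  rw [abs_neg] at this
  simp only [Pi.neg_apply]
  have h : S x + vCoeff a i * Real.log |x - a i| + -S x = vCoeff a i * Real.log |x - a i| := by ring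
  rw [h] at this
  linarith

/-- With `p = x^(1/4)` and `r = 1/p` one has `|log x| ≤ 4(p + r)`, and `16(p + r)² ≤ 32(p² + r²)`.
The bound is integrable at 0. -/
theorem sq_log_le {x : ℝ} (hx : 0 < x) :
    Real.log x ^ 2 ≤ 32 * (x ^ (1 / 2 : ℝ) + x ^ (-1 / 2 : ℝ)) := by
  have h1 := Real.log_le_rpow_div hx.le (ε := 1 / 4) (by norm_num)
  have h2 := Real.log_le_rpow_div (inv_pos.2 hx).le (ε := 1 / 4) (by norm_num)
  rw [Real.log_inv, Real.inv_rpow hx.le, ← Real.rpow_neg hx.le] at h2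
  have p1 := Real.rpow_nonneg hx.le (1 / 4)
  have p2 := Real.rpow_nonneg hx.le (-(1 / 4))
  have e1 : x ^ (1 / 2 : ℝ) = (x ^ (1 / 4 : ℝ)) ^ 2 := by
    rw [← Real.rpow_natCast, ← Real.rpow_mul hx.le]; norm_num
  have e2 : x ^ (-1 / 2 : ℝ) = (x ^ (-(1 / 4) : ℝ)) ^ 2 := by
    rw [← Real.rpow_natCast, ← Real.rpow_mul hx.le]; norm_num
  have e3 : x ^ (1 / 4 : ℝ) * x ^ (-(1 / 4) : ℝ) = 1 := by
    rw [← Real.rpow_add hx]; norm_num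
  rw [e1, e2]
  generalize x ^ (1 / 4 : ℝ) = p at *
  generalize x ^ (-(1 / 4) : ℝ) = r at *
  have : |Real.log x| ≤ 4 * (p + r) := abs_le.2 ⟨by linarith, by linarith⟩
  have h5 := sq_le_sq' (by linarith [abs_nonneg (Real.log x)]) this
  rw [sq_abs] at h5
  nlinarith [sq_nonneg (p - r)]

theorem intervalIntegrable_sq_log (p q : ℝ) :
    IntervalIntegrable (fun x => Real.log x ^ 2) volume p q := by
  refine intervalIntegrable_of_even (fun x => by simp) fun x hx => ?_
  refine IntervalIntegrable.mono_fun' (g := fun y => 32 * (y ^ (1 / 2 : ℝ) + y ^ (-1 / 2 : ℝ))) ?_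
    (by fun_prop) ?_
  · exact ((intervalIntegral.intervalIntegrable_rpow' (by norm_num)).add
      (intervalIntegral.intervalIntegrable_rpow' (by norm_num))).const_mul _
  · rw [uIoc_of_le hx.le]
    refine (ae_restrict_iff' measurableSet_Ioc).2 (Eventually.of_forall fun y hy => ?_)
    simp only [Real.norm_of_nonneg (sq_nonneg _)]
    exact sq_log_le hy.1

theorem memLp_log (c p q : ℝ) :
    MemLp (fun x => Real.log |x - c|) 2 (volume.restrict (Ioo p q)) := by
  rcases le_total q p with h | h
  · simp [Ioo_eq_empty (not_lt.2 h)]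
  rw [memLp_two_iff_integrable_sq (Measurable.aestronglyMeasurable (by fun_prop))]
  have := (intervalIntegrable_sq_log (p - c) (q - c)).comp_sub_right c
  simp only [sub_add_cancel] at this
  simp only [Real.log_abs]
  exact (intervalIntegrable_iff_integrableOn_Ioo_of_le h).1 this

theorem memLp_vFun (a : Fin 4 → ℝ) (p q : ℝ) : MemLp (vFun a) 2 (volume.restrict (Ioo p q)) := by
  have : MemLp (vReal a) 2 (volume.restrict (Ioo p q)) :=
    memLp_finsetSum _ fun i _ => (memLp_log (a i) p q).const_mul (vCoeff a i)
  exact this.ofReal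

theorem twoIntervals_ne {a : Fin 4 → ℝ} (ha : StrictMono a) {x : ℝ} (hx : x ∈ twoIntervals a)
    (i : Fin 4) : x ≠ a i := by
  have h01 : a 0 < a 1 := ha (by decide)
  have h12 : a 1 < a 2 := ha (by decide)
  have h23 : a 2 < a 3 := ha (by decide)
  rintro rfl
  rcases hx with hx | hx <;> fin_cases i <;> simp at hx <;> linarith [hx.1, hx.2]

theorem isOpen_twoIntervals (a : Fin 4 → ℝ) : IsOpen (twoIntervals a) :=
  isOpen_Ioo.union isOpen_Ioo

theorem twoIntervals_subset {a : Fin 4 → ℝ} (ha : StrictMono a) :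
    twoIntervals a ⊆ Ioo (a 1) (a 3) :=
  union_subset (Ioo_subset_Ioo_right (ha (by decide)).le) (Ioo_subset_Ioo_left (ha (by decide)).le)

theorem mem_twoIntervals {a : Fin 4 → ℝ} {x : ℝ} (hx : x ∈ Ioo (a 1) (a 3)) (h : x ≠ a 2) :
    x ∈ twoIntervals a := by
  rcases lt_or_gt_of_ne h with h | h
  · exact Or.inl ⟨hx.1, h⟩
  · exact Or.inr ⟨h, hx.2⟩

theorem ae_mem_twoIntervals (a : Fin 4 → ℝ) : ∀ᵐ x ∂(mu a), x ∈ twoIntervals a :=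
  ae_mu_of (Eventually.of_forall fun _ h => Or.inl h) (Eventually.of_forall fun _ h => Or.inr h)

theorem continuous_P (a : Fin 4 → ℝ) : Continuous (P a) := by
  unfold P; fun_prop

/-! ### Linear systems with integrable coefficients. -/

section Volterra

variable {E : Type*} [NormedAddCommGroup E] [NormedSpace ℝ E]

theorem _root_.IntervalIntegrable.hasDerivAt_primitive {c d : ℝ} {g : ℝ → E} [CompleteSpace E]
    (hg : IntervalIntegrable g volume c d) {x : ℝ} (hx : x ∈ Ioo c d) (hgx : ContinuousAt g x) :
    HasDerivAt (fun y => ∫ t in c..y, g t) (g x) x := by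
  have hcd := hx.1.trans hx.2
  refine intervalIntegral.integral_hasDerivAt_right (hg.mono_set ?_) ?_ hgx
  · rw [uIcc_of_le hx.1.le, uIcc_of_le hcd.le]; exact Icc_subset_Icc_right hx.2.le
  · exact ⟨Ioc c d, Ioc_mem_nhds hx.1 hx.2,
      ((intervalIntegrable_iff_integrableOn_Ioc_of_le hcd.le).1 hg).aestronglyMeasurable⟩

theorem _root_.IntervalIntegrable.clm_apply_continuousOn {c d : ℝ} (hcd : c ≤ d) {M : ℝ → E →L[ℝ] E}
    (hM : IntervalIntegrable M volume c d) {g : ℝ → E} (hg : ContinuousOn g (Icc c d)) :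
    IntervalIntegrable (fun t => M t (g t)) volume c d := by
  rw [intervalIntegrable_iff_integrableOn_Icc_of_le hcd] at *
  obtain ⟨C, hC⟩ := isCompact_Icc.exists_bound_of_continuousOn hg
  refine Integrable.mono' (hM.norm.mul_const C) ?_ ?_
  · exact (ContinuousLinearMap.id ℝ (E →L[ℝ] E)).aestronglyMeasurable_comp₂
      hM.aestronglyMeasurable (hg.aestronglyMeasurable_of_isCompact isCompact_Icc measurableSet_Icc)
  · refine (ae_restrict_iff' measurableSet_Icc).2 (Eventually.of_forall fun x hx => ?_)
    exact (M x).le_of_opNorm_le_of_le le_rfl (hC x hx)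

/-- Existence for a linear system with integrable coefficients, continuous off a countable set. -/
theorem exists_linear_ode_solution [CompleteSpace E] {c d : ℝ} (hcd : c < d) {S : Set ℝ}
    (hS : S.Countable) {M : ℝ → E →L[ℝ] E} (hMc : ∀ x ∈ Ioo c d \ S, ContinuousAt M x)
    (hM : IntervalIntegrable M volume c d) (y₀ : E) :
    ∃ Y : ℝ → E, ContinuousOn Y (Icc c d) ∧ Y c = y₀ ∧
      ∀ x ∈ Ioo c d \ S, HasDerivAt Y (M x (Y x)) x := by
  have sub : ∀ {x}, x ∈ Icc c d → uIcc c x ⊆ uIcc c d := fun {x} hx => by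
    rw [uIcc_of_le hx.1, uIcc_of_le hcd.le]; exact Icc_subset_Icc_right hx.2
  have h2 : IntervalIntegrable (fun t => 2 * ‖M t‖) volume c d := hM.norm.const_mul 2
  -- The weight `exp m` makes the Picard map a contraction on the whole interval at once. The factor
  -- 2 in `m` gives the contraction constant 1/2.
  set m : ℝ → ℝ := fun x => ∫ t in c..x, 2 * ‖M t‖ with hm
  have hmc : ContinuousOn m (Icc c d) := by
    have := intervalIntegral.continuousOn_primitive_interval' h2 left_mem_uIcc
    rwa [uIcc_of_le hcd.le] at this
  have hmd : ∀ x ∈ Ioo c d \ S, HasDerivAt m (2 * ‖M x‖) x := fun x hx =>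
    IntervalIntegrable.hasDerivAt_primitive h2 hx.1 ((hMc x hx).norm.const_mul 2)
  have hexp : ContinuousOn (fun x => Real.exp (m x)) (Icc c d) := hmc.rexp
  have hint : ∀ x ∈ Icc c d,
      ∫ t in c..x, Real.exp (m t) * (2 * ‖M t‖) = Real.exp (m x) - 1 := by
    intro x hx
    have h := integral_eq_of_hasDerivAt_off_countable_of_le
      (fun x => Real.exp (m x)) (fun t => Real.exp (m t) * (2 * ‖M t‖)) hx.1 hS
      (hexp.mono (Icc_subset_Icc_right hx.2))
      (fun t ht => (hmd t ⟨⟨ht.1.1, ht.1.2.trans_le hx.2⟩, ht.2⟩).exp)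
      ((h2.mono_set (sub hx)).continuousOn_mul
        (by rw [uIcc_of_le hx.1]; exact hexp.mono (Icc_subset_Icc_right hx.2)))
    rw [h]; simp [hm]
  have hgc : ∀ Z : C(Icc c d, E),
      ContinuousOn (fun t => Real.exp (m t) • IccExtend hcd.le Z t) (Icc c d) := fun Z =>
    hexp.smul Z.continuous.Icc_extend'.continuousOn
  have hgi : ∀ Z : C(Icc c d, E), IntervalIntegrable
      (fun t => M t (Real.exp (m t) • IccExtend hcd.le Z t)) volume c d := fun Z =>
    IntervalIntegrable.clm_apply_continuousOn hcd.le hM (hgc Z)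
  have hpc : ∀ Z : C(Icc c d, E), ContinuousOn
      (fun x => ∫ t in c..x, M t (Real.exp (m t) • IccExtend hcd.le Z t)) (Icc c d) := fun Z => by
    have := intervalIntegral.continuousOn_primitive_interval' (hgi Z) left_mem_uIcc
    rwa [uIcc_of_le hcd.le] at this
  -- The Picard map written for `Z = exp(-m) Y`, so that the unweighted sup norm of `Z` is the
  -- weighted norm of `Y`.
  set φ : C(Icc c d, E) → ℝ → E := fun Z x =>
    Real.exp (-m x) • (y₀ + ∫ t in c..x, M t (Real.exp (m t) • IccExtend hcd.le Z t)) with hφ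
  have hφc : ∀ Z, ContinuousOn (φ Z) (Icc c d) := fun Z =>
    hmc.neg.rexp.smul ((hpc Z).const_add y₀)
  obtain ⟨Φ, hΦa⟩ : ∃ Φ : C(Icc c d, E) → C(Icc c d, E), ∀ Z x, Φ Z x = φ Z x :=
    ⟨fun Z => ⟨fun x => φ Z x, (hφc Z).domRestrict⟩, fun _ _ => rfl⟩
  have hΦ : ContractingWith (1 / 2) Φ := by
    refine ⟨by rw [← NNReal.coe_lt_coe]; norm_num, LipschitzWith.of_dist_le_mul fun Z Z' => ?_⟩
    rw [ContinuousMap.dist_le (by positivity)]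
    intro x
    have hx := x.2
    have e : Φ Z x - Φ Z' x = Real.exp (-m x) •
        ∫ t in c..x, M t (Real.exp (m t) • (IccExtend hcd.le Z t - IccExtend hcd.le Z' t)) := by
      rw [hΦa, hΦa, hφ]
      beta_reduce
      rw [← smul_sub, add_sub_add_left_eq_sub, ← intervalIntegral.integral_sub
        ((hgi Z).mono_set (sub hx)) ((hgi Z').mono_set (sub hx))]
      simp only [← map_sub, ← smul_sub]
    rw [dist_eq_norm, e, norm_smul, Real.norm_of_nonneg (Real.exp_pos _).le]
    have h3 : ‖∫ t in c..(x : ℝ),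
        M t (Real.exp (m t) • (IccExtend hcd.le Z t - IccExtend hcd.le Z' t))‖ ≤
        ∫ t in c..(x : ℝ), Real.exp (m t) * (2 * ‖M t‖) * (dist Z Z' / 2) := by
      refine intervalIntegral.norm_integral_le_of_norm_le hx.1
        (Eventually.of_forall fun t ht => ?_) ?_
      · refine ((M t).le_opNorm _).trans ?_
        rw [norm_smul, Real.norm_of_nonneg (Real.exp_pos _).le]
        have : ‖IccExtend hcd.le Z t - IccExtend hcd.le Z' t‖ ≤ dist Z Z' := by
          rw [← dist_eq_norm]; exact ContinuousMap.dist_apply_le_dist _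
        calc _ = Real.exp (m t) * ‖M t‖ * ‖IccExtend hcd.le Z t - IccExtend hcd.le Z' t‖ := by ring
          _ ≤ Real.exp (m t) * ‖M t‖ * dist Z Z' := by gcongr
          _ = _ := by ring
      · exact ((h2.mono_set (sub hx)).continuousOn_mul
          (by rw [uIcc_of_le hx.1]; exact hexp.mono (Icc_subset_Icc_right hx.2))).mul_const _
    rw [intervalIntegral.integral_mul_const, hint x hx] at h3
    calc _ ≤ Real.exp (-m x) * ((Real.exp (m x) - 1) * (dist Z Z' / 2)) := by gcongr
      _ = (1 - Real.exp (-m x)) * (dist Z Z' / 2) := by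
        rw [Real.exp_neg]; field_simp
      _ ≤ 1 * (dist Z Z' / 2) := by
        gcongr; linarith [Real.exp_pos (-m x)]
      _ = _ := by push_cast; ring
  obtain ⟨Z, hZ⟩ : ∃ Z, Φ Z = Z := ⟨_, hΦ.fixedPoint_isFixedPt⟩
  have hY : ∀ x ∈ Icc c d, Real.exp (m x) • IccExtend hcd.le Z x =
      y₀ + ∫ t in c..x, M t (Real.exp (m t) • IccExtend hcd.le Z t) := by
    intro x hx
    have := congrArg (fun F : C(Icc c d, E) => F ⟨x, hx⟩) hZ
    beta_reduce at this
    rw [IccExtend_of_mem _ _ hx, ← this, hΦa, hφ]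
    beta_reduce
    rw [Real.exp_neg, smul_inv_smul₀ (Real.exp_pos (m x)).ne']
  refine ⟨fun x => Real.exp (m x) • IccExtend hcd.le Z x, hgc Z, ?_, fun x hx => ?_⟩
  · have := hY c (left_mem_Icc.2 hcd.le)
    simpa using this
  · have hc : ContinuousAt (fun t => M t (Real.exp (m t) • IccExtend hcd.le Z t)) x :=
      (hMc x hx).clm_apply ((hgc Z).continuousAt (Icc_mem_nhds hx.1.1 hx.1.2))
    refine ((IntervalIntegrable.hasDerivAt_primitive (hgi Z) hx.1 hc).const_add
      y₀).congr_of_eventuallyEq ?_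
    filter_upwards [Icc_mem_nhds hx.1.1 hx.1.2] with y hy using hY y hy

end Volterra

/-! ### Local absolute continuity, endpoint limits and square-root bounds. -/

theorem uIcc_subset_Ioo {c d p q : ℝ} (hp : p ∈ Ioo c d) (hq : q ∈ Ioo c d) :
    uIcc p q ⊆ Ioo c d := ordConnected_Ioo.uIcc_subset hp hq

theorem ACloc_of_hasDerivAt {c d : ℝ} {f f' : ℝ → ℂ} (hf : ∀ x ∈ Ioo c d, HasDerivAt f (f' x) x)
    (hf' : ContinuousOn f' (Ioo c d)) : ACloc f (Ioo c d) := by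
  intro p q hpq
  obtain ⟨C, hC⟩ := isCompact_uIcc.exists_bound_of_continuousOn (hf'.mono hpq)
  refine LipschitzOnWith.absolutelyContinuousOnInterval (K := C.toNNReal) ?_
  refine Convex.lipschitzOnWith_of_nnnorm_hasDerivWithin_le (convex_uIcc p q)
    (fun x hx => (hf x (hpq hx)).hasDerivWithinAt) fun x hx => ?_
  exact NNReal.le_toNNReal_of_coe_le (hC x hx)

theorem _root_.IntervalIntegrable.absolutelyContinuousOnInterval_primitive {f : ℝ → ℂ} {p q r : ℝ}
    (hf : IntervalIntegrable f volume p q) (hr : r ∈ uIcc p q) :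
    AbsolutelyContinuousOnInterval (fun x => ∫ t in r..x, f t) p q := by
  have hre : IntervalIntegrable (fun t => (f t).re) volume p q := ⟨hf.1.re, hf.2.re⟩
  have him : IntervalIntegrable (fun t => (f t).im) volume p q := ⟨hf.1.im, hf.2.im⟩
  have h1 := (hre.absolutelyContinuousOnInterval_intervalIntegral hr)
  have h2 := (him.absolutelyContinuousOnInterval_intervalIntegral hr)
  have hc : AbsolutelyContinuousOnInterval (fun _ : ℝ => (1 : ℂ)) p q := by
    simpa [AbsolutelyContinuousOnInterval] using tendsto_const_nhds
  have hi : AbsolutelyContinuousOnInterval (fun _ : ℝ => Complex.I) p q := by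
    simpa [AbsolutelyContinuousOnInterval] using tendsto_const_nhds
  have h3 := (h1.smul hc).add (h2.smul hi)
  have key : EqOn ((fun x => ∫ t in r..x, (f t).re) • (fun _ : ℝ => (1 : ℂ)) +
      (fun x => ∫ t in r..x, (f t).im) • fun _ => Complex.I) (fun x => ∫ t in r..x, f t)
      (uIcc p q) := by
    intro x hx
    have hfx : IntervalIntegrable f volume r x := hf.mono_set (uIcc_subset_uIcc hr hx)
    simp only [Pi.add_apply, Pi.smul_apply', Complex.real_smul, mul_one]
    have e1 : ∫ t in r..x, (f t).re = (∫ t in r..x, f t).re :=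
      Complex.reCLM.intervalIntegral_comp_comm hfx
    have e2 : ∫ t in r..x, (f t).im = (∫ t in r..x, f t).im :=
      Complex.imCLM.intervalIntegral_comp_comm hfx
    rw [e1, e2, Complex.re_add_im]
  have : ACloc _ (uIcc p q) := fun c d hcd => h3.mono hcd
  exact this.congr key p q subset_rfl

/-- A locally absolutely continuous function whose derivative agrees almost everywhere with a
continuous function is continuously differentiable. -/
theorem ACloc.hasDerivAt_of_ae {c d : ℝ} {f g : ℝ → ℂ} (hf : ACloc f (Ioo c d))
    (hg : ContinuousOn g (Ioo c d)) (h : ∀ᵐ x, x ∈ Ioo c d → HasDerivAt f (g x) x) :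
    ∀ x ∈ Ioo c d, HasDerivAt f (g x) x := by
  intro x hx
  obtain ⟨p, hcp, hpx⟩ := exists_between hx.1
  obtain ⟨q, hxq, hqd⟩ := exists_between hx.2
  have hpq : p < q := hpx.trans hxq
  have hsub : uIcc p q ⊆ Ioo c d :=
    uIcc_subset_Ioo ⟨hcp, hpx.trans hx.2⟩ ⟨hx.1.trans hxq, hqd⟩
  have hgi : IntervalIntegrable g volume p q := (hg.mono hsub).intervalIntegrable
  have hG := IntervalIntegrable.absolutelyContinuousOnInterval_primitive hgi left_mem_uIcc
  have hd : ∀ y ∈ Ioo p q, HasDerivAt (fun y => ∫ t in p..y, g t) (g y) y := fun y hy =>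
    IntervalIntegrable.hasDerivAt_primitive hgi hy
      (hg.continuousAt (isOpen_Ioo.mem_nhds
        (hsub (by rw [uIcc_of_le hpq.le]; exact Ioo_subset_Icc_self hy))))
  -- The difference of `f` and the primitive of `g` is absolutely continuous with derivative zero
  -- almost everywhere, hence constant; the primitive is differentiable at every interior point.
  obtain ⟨C, hC⟩ := ((hf p q hsub).sub hG).const_of_ae_hasDerivAt_zero (by
    have hp : ∀ᵐ y : ℝ, y ≠ p := by simp [ae_iff, measure_singleton]
    have hq : ∀ᵐ y : ℝ, y ≠ q := by simp [ae_iff, measure_singleton]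
    filter_upwards [h, hp, hq] with y hy h1 h2 hyI
    have hy' := hyI
    rw [uIcc_of_le hpq.le] at hy'
    simpa using (hy (hsub hyI)).sub
      (hd y ⟨lt_of_le_of_ne hy'.1 (Ne.symm h1), lt_of_le_of_ne hy'.2 h2⟩))
  refine ((hd x ⟨hpx, hxq⟩).const_add C).congr_of_eventuallyEq ?_
  filter_upwards [Icc_mem_nhds hpx hxq] with y hy
  rw [← hC y (by rwa [uIcc_of_le hpq.le])]
  simp

/-- Inside the interval `f` equals `f(m) + ∫_m^x f'`, and this expression is continuous up to the
endpoints. -/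
theorem exists_tendsto_endpoints {c d : ℝ} (hcd : c < d) {f f' : ℝ → ℂ}
    (hf : ∀ x ∈ Ioo c d, HasDerivAt f (f' x) x) (hf' : IntegrableOn f' (Ioo c d)) :
    (∃ l, Tendsto f (𝓝[>] c) (𝓝 l)) ∧ ∃ l, Tendsto f (𝓝[<] d) (𝓝 l) := by
  obtain ⟨m, hm⟩ := exists_between hcd
  have hi : IntervalIntegrable f' volume c d :=
    (intervalIntegrable_iff_integrableOn_Ioo_of_le hcd.le).2 hf'
  have hc : ContinuousOn (fun x => f m + ∫ t in m..x, f' t) (Icc c d) := by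
    have := intervalIntegral.continuousOn_primitive_interval' hi
      (by rw [uIcc_of_le hcd.le]; exact Ioo_subset_Icc_self hm : m ∈ uIcc c d)
    rw [uIcc_of_le hcd.le] at this
    exact this.const_add _
  have he : EqOn (fun x => f m + ∫ t in m..x, f' t) f (Ioo c d) := fun x hx => by
    have := intervalIntegral.integral_eq_sub_of_hasDerivAt
      (fun y hy => hf y (uIcc_subset_Ioo hm hx hy))
      (hi.mono_set ((uIcc_subset_Ioo hm hx).trans
        (by rw [uIcc_of_le hcd.le]; exact Ioo_subset_Icc_self)))
    simp [this]
  constructor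
  · refine ⟨_, ((hc c (left_mem_Icc.2 hcd.le)).tendsto.mono_left
      (nhdsWithin_le_of_mem ?_)).congr' ?_⟩
    · exact Icc_mem_nhdsGT hcd
    · exact he.eventuallyEq_of_mem (Ioo_mem_nhdsGT hcd)
  · refine ⟨_, ((hc d (right_mem_Icc.2 hcd.le)).tendsto.mono_left
      (nhdsWithin_le_of_mem ?_)).congr' ?_⟩
    · exact Icc_mem_nhdsLT hcd
    · exact he.eventuallyEq_of_mem (Ioo_mem_nhdsLT hcd)

/-- The majorant `K/√(x-c)` is the derivative of `2K√(x-c)`. Comparison runs on `[y,x]`, away from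
the singularity, and then `y` tends to `c`. -/
theorem norm_le_sqrt_of_deriv_le {c d K : ℝ} {f f' : ℝ → ℂ}
    (hf : ∀ x ∈ Ioo c d, HasDerivAt f (f' x) x) (h0 : Tendsto f (𝓝[>] c) (𝓝 0))
    (hK : ∀ x ∈ Ioo c d, ‖f' x‖ ≤ K / √(x - c)) {x : ℝ} (hx : x ∈ Ioo c d) :
    ‖f x‖ ≤ 2 * K * √(x - c) := by
  have key : ∀ y ∈ Ioo c x, ‖f x - f y‖ ≤ 2 * K * (√(x - c) - √(y - c)) := by
    intro y hy
    have hs : ∀ t ∈ Icc y x, t ∈ Ioo c d := fun t ht =>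
      ⟨hy.1.trans_le ht.1, ht.2.trans_lt hx.2⟩
    have hB : ∀ t ∈ Icc y x,
        HasDerivAt (fun t => 2 * K * (√(t - c) - √(y - c))) (K / √(t - c)) t := by
      intro t ht
      have h1 := ((((hasDerivAt_id t).sub_const c).sqrt
        (sub_pos.2 (hs t ht).1).ne').sub_const (√(y - c))).const_mul (2 * K)
      refine h1.congr_deriv ?_
      have : √(t - c) ≠ 0 := (Real.sqrt_pos.2 (sub_pos.2 (hs t ht).1)).ne'
      simp only [id]
      field_simp
    exact image_norm_le_of_norm_deriv_right_le_deriv_boundary' (f := fun t => f t - f y)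
      (fun t ht => ((hf t (hs t ht)).sub_const _).continuousAt.continuousWithinAt)
      (fun t ht => ((hf t (hs t (Ico_subset_Icc_self ht))).sub_const _).hasDerivWithinAt)
      (by simp) (fun t ht => (hB t ht).continuousAt.continuousWithinAt)
      (fun t ht => (hB t (Ico_subset_Icc_self ht)).hasDerivWithinAt)
      (fun t ht => hK t (hs t (Ico_subset_Icc_self ht))) (right_mem_Icc.2 hy.2.le)
  have l1 : Tendsto (fun y => ‖f x - f y‖) (𝓝[>] c) (𝓝 ‖f x‖) := by
    simpa using (h0.const_sub (f x)).norm
  have l2 : Tendsto (fun y => 2 * K * (√(x - c) - √(y - c))) (𝓝[>] c) (𝓝 (2 * K * √(x - c))) := by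
    have : ContinuousAt (fun y => 2 * K * (√(x - c) - √(y - c))) c := by fun_prop
    simpa [ContinuousAt] using this.tendsto.mono_left (nhdsWithin_le_nhds (s := Ioi c))
  refine le_of_tendsto_of_tendsto l1 l2 ?_
  filter_upwards [Ioo_mem_nhdsGT hx.1] with y hy using key y hy

theorem norm_le_sqrt_of_deriv_le_left {c d K : ℝ} {f f' : ℝ → ℂ}
    (hf : ∀ x ∈ Ioo c d, HasDerivAt f (f' x) x) (h0 : Tendsto f (𝓝[<] d) (𝓝 0))
    (hK : ∀ x ∈ Ioo c d, ‖f' x‖ ≤ K / √(d - x)) {x : ℝ} (hx : x ∈ Ioo c d) :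
    ‖f x‖ ≤ 2 * K * √(d - x) := by
  have hneg : ∀ {t}, t ∈ Ioo (-d) (-c) → -t ∈ Ioo c d := fun {t} ht =>
    ⟨by linarith [ht.2], by linarith [ht.1]⟩
  have h := norm_le_sqrt_of_deriv_le (c := -d) (d := -c) (K := K) (f := fun t => f (-t))
    (f' := fun t => -f' (-t)) (fun t ht => ?_) ?_ (fun t ht => ?_) (x := -x)
    ⟨by linarith [hx.2], by linarith [hx.1]⟩
  · simpa [neg_add_eq_sub] using h
  · have h := HasDerivAt.scomp t (hf _ (hneg ht)) (hasDerivAt_neg t)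
    rw [neg_one_smul] at h
    exact h
  · exact h0.comp (tendsto_neg_nhdsGT_neg (a := d))
  · rw [norm_neg, show t - -d = d - -t by ring]
    exact hK _ (hneg ht)

/-! ### Compactness of primitive-then-multiply operators on `L²`. -/

open BoundedContinuousFunction in
theorem isCompactOperator_of_equicontinuous {X E : Type*} [TopologicalSpace X] [CompactSpace X]
    [NormedAddCommGroup E] [NormedSpace ℂ E] (T : E →L[ℂ] (X →ᵇ ℂ))
    (h : ∀ x₀ : X, ∀ ε > 0, ∀ᶠ x in 𝓝 x₀, ∀ f : E, ‖T f x₀ - T f x‖ ≤ ε * ‖f‖) :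
    IsCompactOperator T := by
  rw [← ContinuousLinearMap.coe_coe,
    isCompactOperator_iff_isCompact_closure_image_closedBall _ one_pos]
  refine arzela_ascoli (Metric.closedBall 0 ‖T‖) (isCompact_closedBall _ _) _ ?_ ?_
  · rintro _ x ⟨f, hf, rfl⟩
    rw [mem_closedBall_zero_iff] at hf ⊢
    refine ((T f).norm_coe_le_norm x).trans ((T.le_opNorm f).trans ?_)
    exact mul_le_of_le_one_right (norm_nonneg _) hf
  · intro x₀
    rw [Metric.equicontinuousAt_iff_right]
    intro ε hε
    filter_upwards [h x₀ (ε / 2) (half_pos hε)] with x hx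
    rintro ⟨_, f, hf, rfl⟩
    rw [mem_closedBall_zero_iff] at hf
    rw [dist_eq_norm]
    refine (hx f).trans_lt ?_
    calc ε / 2 * ‖f‖ ≤ ε / 2 * 1 := by gcongr
      _ < ε := by linarith

section Primitive

variable {c d : ℝ}

theorem intervalIntegrable_mul (hcd : c ≤ d) {h f : ℝ → ℂ}
    (hh : MemLp h 2 (volume.restrict (Ioo c d))) (hf : MemLp f 2 (volume.restrict (Ioo c d))) :
    IntervalIntegrable (fun t => h t * f t) volume c d :=
  (intervalIntegrable_iff_integrableOn_Ioo_of_le hcd).2 (hh.integrable_mul hf)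

theorem intervalIntegrable_norm_sq (hcd : c ≤ d) {h : ℝ → ℂ}
    (hh : MemLp h 2 (volume.restrict (Ioo c d))) :
    IntervalIntegrable (fun t => ‖h t‖ ^ 2) volume c d :=
  (intervalIntegrable_iff_integrableOn_Ioo_of_le hcd).2
    ((memLp_two_iff_integrable_sq_norm hh.1).1 hh)

/-- Cauchy-Schwarz on a subinterval. -/
theorem norm_integral_mul_le {h : ℝ → ℂ}
    (hh : MemLp h 2 (volume.restrict (Ioo c d))) (f : Lp ℂ 2 (volume.restrict (Ioo c d)))
    {y x : ℝ} (hy : y ∈ Icc c d) (hx : x ∈ Icc c d) :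
    ‖∫ t in y..x, h t * f t‖ ≤ √|∫ t in y..x, ‖h t‖ ^ 2| * ‖f‖ := by
  have hsub : uIoc y x ⊆ Ioc c d := fun t ht =>
    ⟨(le_min hy.1 hx.1).trans_lt ht.1, ht.2.trans (max_le hy.2 hx.2)⟩
  have hμ : volume.restrict (uIoc y x) ≤ volume.restrict (Ioo c d) := by
    rw [restrict_Ioo_eq_restrict_Ioc]; exact Measure.restrict_mono hsub le_rfl
  have hh' := hh.mono_measure hμ
  have hf' := (Lp.memLp f).mono_measure hμ
  have two : ENNReal.ofReal 2 = 2 := by simp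
  have hol := integral_mul_norm_le_Lp_mul_Lq (μ := volume.restrict (uIoc y x))
    (Real.holderConjugate_iff.2 ⟨one_lt_two, by norm_num⟩ : (2 : ℝ).HolderConjugate 2)
    (f := h) (g := f) (by rwa [two]) (by rwa [two])
  simp only [← Real.sqrt_eq_rpow, Real.rpow_two] at hol
  refine (intervalIntegral.norm_integral_le_integral_norm_uIoc).trans ?_
  simp only [norm_mul]
  refine hol.trans ?_
  rw [intervalIntegral.abs_integral_eq_abs_integral_uIoc,
    abs_of_nonneg (integral_nonneg fun _ => by positivity)]
  gcongr
  rw [Lp.norm_def, eLpNorm_eq_lintegral_rpow_enorm_toReal (by simp) (by simp)]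
  rw [← ENNReal.toReal_rpow]
  simp only [ENNReal.toReal_ofNat, ← Real.sqrt_eq_rpow]
  refine Real.sqrt_le_sqrt ?_
  have e : ∫ a in Ioo c d, ‖f a‖ ^ 2 = (∫⁻ x in Ioo c d, ‖f x‖ₑ ^ (2 : ℝ)).toReal := by
    rw [integral_eq_lintegral_of_nonneg_ae (Eventually.of_forall fun _ => sq_nonneg _)
      (by exact (Lp.memLp f).1.norm.pow 2)]
    congr 2 with x
    rw [← ofReal_norm, ENNReal.ofReal_rpow_of_nonneg (norm_nonneg _) (by norm_num)]
    norm_num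
  rw [← e]
  exact integral_mono_measure hμ (Eventually.of_forall fun _ => by positivity)
    ((memLp_two_iff_integrable_sq_norm (Lp.memLp f).1).1 (Lp.memLp f))

theorem continuousOn_primitive_mul (hcd : c ≤ d) {h f : ℝ → ℂ}
    (hh : MemLp h 2 (volume.restrict (Ioo c d))) (hf : MemLp f 2 (volume.restrict (Ioo c d)))
    {p : ℝ} (hp : p ∈ Icc c d) :
    ContinuousOn (fun x => ∫ t in p..x, h t * f t) (Icc c d) := by
  have := intervalIntegral.continuousOn_primitive_interval' (intervalIntegrable_mul hcd hh hf)
    (by rwa [uIcc_of_le hcd] : p ∈ uIcc c d)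
  rwa [uIcc_of_le hcd] at this

theorem _root_.IntervalIntegrable.mono_Icc {E : Type*} [NormedAddCommGroup E] {g : ℝ → E}
    (hg : IntervalIntegrable g volume c d) {x y : ℝ} (hx : x ∈ Icc c d) (hy : y ∈ Icc c d) :
    IntervalIntegrable g volume x y :=
  hg.mono_set (by
    have hcd := hx.1.trans hx.2
    rw [uIcc_of_le hcd]
    exact ordConnected_Icc.uIcc_subset hx hy)

/-- The operator `f ↦ ∫_p^x h f` from `L²(c, d)` to the continuous functions on `[c, d]`. -/
theorem exists_primitive_clm (hcd : c ≤ d) {h : ℝ → ℂ}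
    (hh : MemLp h 2 (volume.restrict (Ioo c d))) {p : ℝ} (hp : p ∈ Icc c d) :
    ∃ T : Lp ℂ 2 (volume.restrict (Ioo c d)) →L[ℂ] BoundedContinuousFunction (Icc c d) ℂ,
      IsCompactOperator T ∧ ∀ f x, T f x = ∫ t in p..x, h t * f t := by
  have hi : ∀ f : Lp ℂ 2 (volume.restrict (Ioo c d)),
      IntervalIntegrable (fun t => h t * f t) volume c d := fun f =>
    intervalIntegrable_mul hcd hh (Lp.memLp f)
  have hs := intervalIntegrable_norm_sq hcd hh
  obtain ⟨Φ, hΦ⟩ : ∃ Φ : Lp ℂ 2 (volume.restrict (Ioo c d)) →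
      BoundedContinuousFunction (Icc c d) ℂ, ∀ f x, Φ f x = ∫ t in p..x, h t * f t :=
    ⟨fun f => BoundedContinuousFunction.mkOfCompact ⟨fun x => ∫ t in p..x, h t * f t,
      (continuousOn_primitive_mul hcd hh (Lp.memLp f) hp).domRestrict⟩, fun _ _ => rfl⟩
  let T₀ : Lp ℂ 2 (volume.restrict (Ioo c d)) →ₗ[ℂ] BoundedContinuousFunction (Icc c d) ℂ :=
    { toFun := Φ
      map_add' := fun f g => by
        ext x
        rw [BoundedContinuousFunction.add_apply, hΦ, hΦ, hΦ]
        rw [← intervalIntegral.integral_add ((hi f).mono_Icc hp x.2) ((hi g).mono_Icc hp x.2)]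
        refine intervalIntegral.integral_congr_ae_restrict ?_
        have hμ : volume.restrict (uIoc p x) ≤ volume.restrict (Ioo c d) := by
          rw [restrict_Ioo_eq_restrict_Ioc]
          refine Measure.restrict_mono (fun t ht => ?_) le_rfl
          exact ⟨(le_min hp.1 x.2.1).trans_lt ht.1, ht.2.trans (max_le hp.2 x.2.2)⟩
        filter_upwards [(Measure.absolutelyContinuous_of_le hμ).ae_le (Lp.coeFn_add f g)] with t ht
        rw [ht, Pi.add_apply, mul_add]
      map_smul' := fun k f => by
        ext x
        rw [RingHom.id_apply, BoundedContinuousFunction.smul_apply, hΦ, hΦ, smul_eq_mul]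
        rw [← intervalIntegral.integral_const_mul]
        refine intervalIntegral.integral_congr_ae_restrict ?_
        have hμ : volume.restrict (uIoc p x) ≤ volume.restrict (Ioo c d) := by
          rw [restrict_Ioo_eq_restrict_Ioc]
          refine Measure.restrict_mono (fun t ht => ?_) le_rfl
          exact ⟨(le_min hp.1 x.2.1).trans_lt ht.1, ht.2.trans (max_le hp.2 x.2.2)⟩
        filter_upwards [(Measure.absolutelyContinuous_of_le hμ).ae_le (Lp.coeFn_smul k f)] with t ht
        rw [ht, Pi.smul_apply, smul_eq_mul]; ring }
  have hT₀ : ∀ f x, T₀ f x = ∫ t in p..x, h t * f t := hΦ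
  have hbound : ∀ f, ‖T₀ f‖ ≤ √(∫ t in c..d, ‖h t‖ ^ 2) * ‖f‖ := by
    intro f
    rw [BoundedContinuousFunction.norm_le (by positivity)]
    intro x
    rw [hT₀]
    refine (norm_integral_mul_le hh f hp x.2).trans ?_
    gcongr
    refine (intervalIntegral.abs_integral_mono_interval (c := c) (d := d) ?_
      (Eventually.of_forall fun _ => by positivity) hs).trans_eq
        (abs_of_nonneg (intervalIntegral.integral_nonneg hcd fun _ _ => by positivity))
    rw [uIoc_of_le hcd]
    exact fun t ht => ⟨(le_min hp.1 x.2.1).trans_lt ht.1, ht.2.trans (max_le hp.2 x.2.2)⟩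
  refine ⟨T₀.mkContinuous _ hbound, ?_, hT₀⟩
  refine isCompactOperator_of_equicontinuous _ fun x₀ ε hε => ?_
  -- By Cauchy-Schwarz this is a modulus of continuity for `T f` at `x₀` that depends on `f` only
  -- through the factor `‖f‖`; it gives the equicontinuity needed for Arzelà-Ascoli.
  have hc : Continuous fun x : Icc c d => √|∫ t in (x : ℝ)..x₀, ‖h t‖ ^ 2| := by
    have := intervalIntegral.continuousOn_primitive_interval' hs
      (by rw [uIcc_of_le hcd]; exact x₀.2 : (x₀ : ℝ) ∈ uIcc c d)
    rw [uIcc_of_le hcd] at this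
    simp only [intervalIntegral.integral_symm (x₀ : ℝ), abs_neg]
    exact (this.domRestrict).abs.sqrt
  have hlt : ∀ᶠ x : Icc c d in 𝓝 x₀, √|∫ t in (x : ℝ)..x₀, ‖h t‖ ^ 2| < ε :=
    hc.continuousAt.eventually_lt continuousAt_const (by simpa using hε)
  filter_upwards [hlt] with x hx f
  simp only [LinearMap.mkContinuous_apply, hT₀]
  rw [intervalIntegral.integral_interval_sub_left ((hi f).mono_Icc hp x₀.2)
    ((hi f).mono_Icc hp x.2)]
  refine (norm_integral_mul_le hh f x.2 x₀.2).trans ?_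
  gcongr

/-- Multiplication by a square-integrable function, from the continuous functions on `[c, d]` to
`L²(c, d)`. -/
theorem exists_mul_clm (hcd : c ≤ d) {h : ℝ → ℂ} (hh : MemLp h 2 (volume.restrict (Ioo c d))) :
    ∃ m : BoundedContinuousFunction (Icc c d) ℂ →L[ℂ] Lp ℂ 2 (volume.restrict (Ioo c d)),
      ∀ φ, m φ =ᵐ[volume.restrict (Ioo c d)] fun x => h x * IccExtend hcd φ x := by
  have hm : ∀ φ : BoundedContinuousFunction (Icc c d) ℂ,
      MemLp (fun x => h x * IccExtend hcd φ x) 2 (volume.restrict (Ioo c d)) := fun φ => by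
    refine MemLp.of_le_mul (c := ‖φ‖) hh
      (hh.1.mul φ.continuous.Icc_extend'.aestronglyMeasurable) (Eventually.of_forall fun x => ?_)
    rw [norm_mul, mul_comm]
    gcongr
    exact φ.norm_coe_le_norm _
  let m₀ : BoundedContinuousFunction (Icc c d) ℂ →ₗ[ℂ] Lp ℂ 2 (volume.restrict (Ioo c d)) :=
    { toFun := fun φ => (hm φ).toLp _
      map_add' := fun φ χ => by
        rw [← MemLp.toLp_add]
        refine MemLp.toLp_congr _ _ (Eventually.of_forall fun x => ?_)
        simp [IccExtend, mul_add]
      map_smul' := fun k φ => by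
        rw [RingHom.id_apply, ← MemLp.toLp_const_smul]
        refine MemLp.toLp_congr _ _ (Eventually.of_forall fun x => ?_)
        simp only [IccExtend, Function.comp_apply, BoundedContinuousFunction.coe_smul, smul_eq_mul,
          Pi.smul_apply]
        ring }
  refine ⟨m₀.mkContinuous ‖hh.toLp h‖ fun φ => ?_, fun φ => (hm φ).coeFn_toLp⟩
  rw [mul_comm]
  refine Lp.norm_le_mul_norm_of_ae_le_mul ?_
  filter_upwards [(hm φ).coeFn_toLp, hh.coeFn_toLp] with x h1 h2
  change ‖((hm φ).toLp _ : Lp ℂ 2 (volume.restrict (Ioo c d))) x‖ ≤ _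
  rw [h1, h2, norm_mul, mul_comm]
  gcongr
  exact φ.norm_coe_le_norm _

/-- The integral operator with kernel `h(x) g(ξ)` for `ξ` between `p` and `x`. -/
theorem exists_compact_mul_primitive (hcd : c ≤ d) {h g : ℝ → ℂ}
    (hh : MemLp h 2 (volume.restrict (Ioo c d))) (hg : MemLp g 2 (volume.restrict (Ioo c d)))
    {p : ℝ} (hp : p ∈ Icc c d) :
    ∃ R : Lp ℂ 2 (volume.restrict (Ioo c d)) →L[ℂ] Lp ℂ 2 (volume.restrict (Ioo c d)),
      IsCompactOperator R ∧ ∀ f, R f =ᵐ[volume.restrict (Ioo c d)]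
        fun x => h x * ∫ t in p..x, g t * f t := by
  obtain ⟨T, hT, hTf⟩ := exists_primitive_clm hcd hg hp
  obtain ⟨m, hm⟩ := exists_mul_clm hcd hh
  refine ⟨m.comp T, hT.clm_comp m, fun f => ?_⟩
  filter_upwards [hm (T f), ae_restrict_mem measurableSet_Ioo] with x hx hxm
  rw [ContinuousLinearMap.comp_apply, hx, IccExtend_of_mem _ _ (Ioo_subset_Icc_self hxm), hTf]

end Primitive

/-! ### Regularised boundary data, Wronskian and energy. -/

/-- The coefficient in `(P h')' = (z - 2 (x - σ)²) h`. -/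
def solCoeff (a : Fin 4 → ℝ) (z : ℂ) (x : ℝ) : ℂ := z - 2 * ((x : ℂ) - (sigma a : ℂ)) ^ 2

/-- `h = A + v B` with `B = P h'`, and `A`, `B` extend continuously to `[a₂, a₄]`. -/
structure BoundaryData (a : Fin 4 → ℝ) (h A B : ℝ → ℂ) : Prop where
  contA : ContinuousOn A (Icc (a 1) (a 3))
  contB : ContinuousOn B (Icc (a 1) (a 3))
  eq : ∀ x ∈ twoIntervals a, h x = A x + vFun a x * B x
  deriv : ∀ x ∈ twoIntervals a, HasDerivAt h (B x / (P a x : ℂ)) x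

/-- Boundary data of a solution of `(L - z) h = 0`. -/
structure SolutionData (a : Fin 4 → ℝ) (z : ℂ) (h A B : ℝ → ℂ) : Prop
    extends BoundaryData a h A B where
  derivB : ∀ x ∈ twoIntervals a, HasDerivAt B (solCoeff a z x * h x) x

theorem continuous_solCoeff (a : Fin 4 → ℝ) (z : ℂ) : Continuous (solCoeff a z) := by
  unfold solCoeff; fun_prop

theorem L_eq_iff (a : Fin 4 → ℝ) (z : ℂ) (h : ℝ → ℂ) (x : ℝ) :
    L a h x = z * h x ↔ deriv (quasiDeriv a h) x = solCoeff a z x * h x := by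
  rw [L, solCoeff, sub_mul, eq_sub_iff_add_eq]

theorem lagrange_uFun (a : Fin 4 → ℝ) (h : ℝ → ℂ) (x : ℝ) :
    lagrange a h uFun x = -quasiDeriv a h x := by
  simp [lagrange, uFun, quasiDeriv]

/-- Because `v` is real and `P v' = 1`, the bracket with `v` is the coefficient `A` in `h = A + v
B`; the bracket with `u` is `-B`. Transmission therefore means continuity of `A` and `B`. -/
theorem lagrange_vFun {a : Fin 4 → ℝ} (ha : StrictMono a) (h : ℝ → ℂ) {x : ℝ}
    (hx : ∀ i, x ≠ a i) :
    lagrange a h (vFun a) x = h x - vFun a x * quasiDeriv a h x := by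
  have h1 : (fun y => (starRingEnd ℂ) (vFun a y)) = vFun a := by
    ext y; rw [vFun_eq, Complex.conj_ofReal]
  have h2 : quasiDeriv a (vFun a) x = 1 := by
    have : (P a x : ℂ) ≠ 0 := Complex.ofReal_ne_zero.2 (P_ne_zero hx)
    rw [quasiDeriv, (hasDerivAt_vFun ha hx).deriv, mul_one_div_cancel this]
  rw [lagrange, h1, h2, mul_one, vFun_eq, Complex.conj_ofReal]

theorem P_cast_ne_zero {a : Fin 4 → ℝ} (ha : StrictMono a) {x : ℝ} (hx : x ∈ twoIntervals a) :
    (P a x : ℂ) ≠ 0 :=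
  Complex.ofReal_ne_zero.2 (P_ne_zero (twoIntervals_ne ha hx))

theorem closure_twoIntervals {a : Fin 4 → ℝ} (ha : StrictMono a) :
    closure (twoIntervals a) = Icc (a 1) (a 3) := by
  have h12 : a 1 < a 2 := ha (by decide)
  have h23 : a 2 < a 3 := ha (by decide)
  rw [twoIntervals, closure_union, closure_Ioo h12.ne, closure_Ioo h23.ne,
    Icc_union_Icc_eq_Icc h12.le h23.le]


theorem twoIntervals_mem_nhdsGT_left {a : Fin 4 → ℝ} (ha : StrictMono a) :
    twoIntervals a ∈ 𝓝[>] (a 1) :=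
  mem_of_superset (Ioo_mem_nhdsGT (ha (by decide))) subset_union_left

theorem twoIntervals_mem_nhdsLT_mid {a : Fin 4 → ℝ} (ha : StrictMono a) :
    twoIntervals a ∈ 𝓝[<] (a 2) :=
  mem_of_superset (Ioo_mem_nhdsLT (ha (by decide))) subset_union_left

theorem twoIntervals_mem_nhdsGT_mid {a : Fin 4 → ℝ} (ha : StrictMono a) :
    twoIntervals a ∈ 𝓝[>] (a 2) :=
  mem_of_superset (Ioo_mem_nhdsGT (ha (by decide))) subset_union_right

theorem twoIntervals_mem_nhdsLT_right {a : Fin 4 → ℝ} (ha : StrictMono a) :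
    twoIntervals a ∈ 𝓝[<] (a 3) :=
  mem_of_superset (Ioo_mem_nhdsLT (ha (by decide))) subset_union_right

theorem tendsto_of_continuousOn_Icc {a : Fin 4 → ℝ} (ha : StrictMono a) {f : ℝ → ℂ}
    (hf : ContinuousOn f (Icc (a 1) (a 3))) {F : Filter ℝ} {c : ℝ} (hc : c ∈ Icc (a 1) (a 3))
    (hF : F ≤ 𝓝 c) (hF' : twoIntervals a ∈ F) : Tendsto f F (𝓝 (f c)) :=
  (hf c hc).tendsto.mono_left (le_inf hF (le_principal_iff.2
    (mem_of_superset hF' ((twoIntervals_subset ha).trans Ioo_subset_Icc_self))))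

theorem mem_Icc_one {a : Fin 4 → ℝ} (ha : StrictMono a) : a 1 ∈ Icc (a 1) (a 3) :=
  left_mem_Icc.2 (ha.monotone (by decide))

theorem mem_Icc_two {a : Fin 4 → ℝ} (ha : StrictMono a) : a 2 ∈ Icc (a 1) (a 3) :=
  ⟨ha.monotone (by decide), ha.monotone (by decide)⟩

theorem mem_Icc_three {a : Fin 4 → ℝ} (ha : StrictMono a) : a 3 ∈ Icc (a 1) (a 3) :=
  right_mem_Icc.2 (ha.monotone (by decide))

namespace BoundaryData

variable {a : Fin 4 → ℝ} {h A B : ℝ → ℂ}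

theorem quasiDeriv_eq (H : BoundaryData a h A B) (ha : StrictMono a) {x : ℝ}
    (hx : x ∈ twoIntervals a) : quasiDeriv a h x = B x := by
  rw [quasiDeriv, (H.deriv x hx).deriv, mul_div_cancel₀ _ (P_cast_ne_zero ha hx)]

theorem tendsto_lagrange_uFun (H : BoundaryData a h A B) (ha : StrictMono a) {F : Filter ℝ} {c : ℝ}
    (hc : c ∈ Icc (a 1) (a 3)) (hF : F ≤ 𝓝 c) (hF' : twoIntervals a ∈ F) :
    Tendsto (lagrange a h uFun) F (𝓝 (-B c)) := by
  refine (tendsto_of_continuousOn_Icc ha H.contB hc hF hF').neg.congr' ?_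
  filter_upwards [hF'] with x hx
  rw [lagrange_uFun, H.quasiDeriv_eq ha hx]

theorem tendsto_lagrange_vFun (H : BoundaryData a h A B) (ha : StrictMono a) {F : Filter ℝ} {c : ℝ}
    (hc : c ∈ Icc (a 1) (a 3)) (hF : F ≤ 𝓝 c) (hF' : twoIntervals a ∈ F) :
    Tendsto (lagrange a h (vFun a)) F (𝓝 (A c)) := by
  refine (tendsto_of_continuousOn_Icc ha H.contA hc hF hF').congr' ?_
  filter_upwards [hF'] with x hx
  rw [lagrange_vFun ha h (twoIntervals_ne ha hx), H.quasiDeriv_eq ha hx, H.eq x hx]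
  ring

theorem transmits_uFun (H : BoundaryData a h A B) (ha : StrictMono a) : Transmits a h uFun :=
  ⟨_, H.tendsto_lagrange_uFun ha (mem_Icc_two ha) nhdsWithin_le_nhds
      (twoIntervals_mem_nhdsLT_mid ha),
    H.tendsto_lagrange_uFun ha (mem_Icc_two ha) nhdsWithin_le_nhds
      (twoIntervals_mem_nhdsGT_mid ha)⟩

theorem transmits_vFun (H : BoundaryData a h A B) (ha : StrictMono a) : Transmits a h (vFun a) :=
  ⟨_, H.tendsto_lagrange_vFun ha (mem_Icc_two ha) nhdsWithin_le_nhds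
      (twoIntervals_mem_nhdsLT_mid ha),
    H.tendsto_lagrange_vFun ha (mem_Icc_two ha) nhdsWithin_le_nhds
      (twoIntervals_mem_nhdsGT_mid ha)⟩

theorem memLp (H : BoundaryData a h A B) : MemLp h 2 (mu a) := by
  obtain ⟨C, hC⟩ := isCompact_Icc.exists_bound_of_continuousOn H.contA
  obtain ⟨D, hD⟩ := isCompact_Icc.exists_bound_of_continuousOn H.contB
  have mA : AEStronglyMeasurable A (mu a) :=
    (H.contA.mono Ioo_subset_Icc_self).aestronglyMeasurable measurableSet_Ioo
  have mB : AEStronglyMeasurable B (mu a) :=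
    (H.contB.mono Ioo_subset_Icc_self).aestronglyMeasurable measurableSet_Ioo
  have h1 : MemLp A 2 (mu a) := MemLp.of_bound mA C
    ((ae_restrict_iff' measurableSet_Ioo).2
      (Eventually.of_forall fun x hx => hC x (Ioo_subset_Icc_self hx)))
  have h2 : MemLp (fun x => vFun a x * B x) 2 (mu a) := by
    refine MemLp.of_le_mul (c := D) (memLp_vFun a (a 1) (a 3)) ((memLp_vFun a _ _).1.mul mB)
      ((ae_restrict_iff' measurableSet_Ioo).2 (Eventually.of_forall fun x hx => ?_))
    rw [norm_mul, mul_comm]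
    gcongr
    exact hD x (Ioo_subset_Icc_self hx)
  refine (h1.add h2).ae_eq ?_
  filter_upwards [ae_mem_twoIntervals a] with x hx using (H.eq x hx).symm

theorem logarithmicAlong (H : BoundaryData a h A B) (ha : StrictMono a) {F : Filter ℝ} {i : Fin 4}
    (hF : twoIntervals a ∈ F) (hi : a i ∈ Icc (a 1) (a 3)) (hB : B (a i) ≠ 0) :
    LogarithmicAlong F (a i) h := by
  obtain ⟨S, hS, hv⟩ := exists_vReal_split ha i
  have h13 : a 1 ≤ a 3 := ha.monotone (by decide)
  -- `LogarithmicAlong` asks for coefficients continuous on both sides of the point, so `A` and `B`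
  -- are continued as constants beyond `[a₂,a₄]`.
  have cA : Continuous (IccExtend h13 ((Icc (a 1) (a 3)).domRestrict A)) :=
    H.contA.domRestrict.Icc_extend'
  have cB : Continuous (IccExtend h13 ((Icc (a 1) (a 3)).domRestrict B)) :=
    H.contB.domRestrict.Icc_extend'
  refine ⟨fun x => IccExtend h13 ((Icc (a 1) (a 3)).domRestrict A) x +
      S x * IccExtend h13 ((Icc (a 1) (a 3)).domRestrict B) x,
    fun x => vCoeff a i * IccExtend h13 ((Icc (a 1) (a 3)).domRestrict B) x,
    cA.continuousAt.add ((Complex.continuous_ofReal.continuousAt.comp hS).mul cB.continuousAt),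
    cB.continuousAt.const_mul _, ?_, ?_⟩
  · beta_reduce
    rw [IccExtend_of_mem _ _ hi]
    exact mul_ne_zero (Complex.ofReal_ne_zero.2 (vCoeff_ne_zero ha i)) hB
  · filter_upwards [hF] with x hx
    have hx' := Ioo_subset_Icc_self (twoIntervals_subset ha hx)
    rw [IccExtend_of_mem _ _ hx', IccExtend_of_mem _ _ hx', H.eq x hx, vFun_eq, hv]
    simp only [domRestrict_apply]
    push_cast
    ring

/-- Continuity carries the vanishing of `A` and `B` to the closed interval, so nonzero data at a
singular endpoint excludes a solution that vanishes next to it. -/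
theorem eq_zero_of_eqOn (H : BoundaryData a h A B) (ha : StrictMono a) {p q : ℝ} (hpq : p < q)
    (hs : Ioo p q ⊆ twoIntervals a) (h0 : ∀ x ∈ Ioo p q, h x = 0) :
    ∀ x ∈ Icc p q, A x = 0 ∧ B x = 0 := by
  have hB : EqOn B 0 (Ioo p q) := fun x hx => by
    have h1 : HasDerivAt h 0 x := (hasDerivAt_const x (0 : ℂ)).congr_of_eventuallyEq
      (by filter_upwards [isOpen_Ioo.mem_nhds hx] with y hy using h0 y hy)
    have := (H.deriv x (hs hx)).unique h1
    simpa [P_cast_ne_zero ha (hs hx)] using this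
  have hA : EqOn A 0 (Ioo p q) := fun x hx => by
    have := H.eq x (hs hx)
    rw [h0 x hx, hB hx] at this
    simpa using this.symm
  have hI : Icc p q ⊆ Icc (a 1) (a 3) := by
    rw [← closure_Ioo hpq.ne, ← closure_twoIntervals ha]
    exact closure_mono hs
  have hcl : Icc p q ⊆ closure (Ioo p q) := (closure_Ioo hpq.ne).ge
  intro x hx
  exact ⟨hA.of_subset_closure (H.contA.mono hI) continuousOn_const Ioo_subset_Icc_self hcl hx,
    hB.of_subset_closure (H.contB.mono hI) continuousOn_const Ioo_subset_Icc_self hcl hx⟩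

end BoundaryData

namespace SolutionData

variable {a : Fin 4 → ℝ} {z : ℂ} {h A B : ℝ → ℂ}

theorem isSolution (H : SolutionData a z h A B) (ha : StrictMono a) : IsSolution a z h := by
  intro x hx
  have he : quasiDeriv a h =ᶠ[𝓝 x] B := by
    filter_upwards [(isOpen_twoIntervals a).mem_nhds hx] with y hy
      using H.toBoundaryData.quasiDeriv_eq ha hy
  have hd := (H.derivB x hx).congr_of_eventuallyEq he
  exact ⟨(H.deriv x hx).differentiableAt, hd.differentiableAt, (L_eq_iff _ _ _ _).2 hd.deriv⟩

/-- The terms with `v` cancel, so this is the classical `P`-weighted Wronskian `h₁B₂ - h₂B₁`, whose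
derivative is zero off `a₃`. Continuity of the data makes the constant the same on both sides of
`a₃`. -/
theorem wronskian_eq {h₁ A₁ B₁ h₂ A₂ B₂ : ℝ → ℂ}
    (H₁ : SolutionData a z h₁ A₁ B₁) (H₂ : SolutionData a z h₂ A₂ B₂) {x : ℝ}
    (hx : x ∈ Icc (a 1) (a 3)) :
    A₁ x * B₂ x - A₂ x * B₁ x = A₁ (a 1) * B₂ (a 1) - A₂ (a 1) * B₁ (a 1) := by
  have h := integral_eq_of_hasDerivAt_off_countable_of_le
    (fun x => A₁ x * B₂ x - A₂ x * B₁ x) (fun _ => 0) hx.1 (countable_singleton (a 2))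
    ((((H₁.contA.mul H₂.contB).sub (H₂.contA.mul H₁.contB))).mono (Icc_subset_Icc_right hx.2))
    (fun y hy => ?_) (by simp)
  · simp only [intervalIntegral.integral_zero] at h
    exact (sub_eq_zero.1 h.symm)
  · have hy' : y ∈ twoIntervals a :=
      mem_twoIntervals ⟨hy.1.1, hy.1.2.trans_le hx.2⟩ (fun h => hy.2 h)
    have hd := ((H₁.deriv y hy').mul (H₂.derivB y hy')).sub
      ((H₂.deriv y hy').mul (H₁.derivB y hy'))
    refine (hd.congr_deriv ?_).congr_of_eventuallyEq ?_
    · ring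
    · filter_upwards [(isOpen_twoIntervals a).mem_nhds hy'] with t ht
      simp only [Pi.sub_apply, Pi.mul_apply]
      rw [H₁.eq t ht, H₂.eq t ht]
      ring

/-- The boundary form `[h, h]` is `2i Im (A B̄)`, and `Im (A B̄)` decreases at the rate `|h|²`. -/
theorem hasDerivAt_energy (H : SolutionData a Complex.I h A B) {x : ℝ}
    (hx : x ∈ twoIntervals a) :
    HasDerivAt (fun y => (A y * (starRingEnd ℂ) (B y)).im) (-‖h x‖ ^ 2) x := by
  have hd := (H.deriv x hx).mul (H.derivB x hx).star
  have him := Complex.imCLM.hasFDerivAt.comp_hasDerivAt x hd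
  refine (him.congr_deriv ?_).congr_of_eventuallyEq ?_
  · simp only [Complex.imCLM_apply, Complex.star_def, map_mul]
    -- `P` is real, so this term is `|B|²/P` and drops out; only the imaginary part of the spectral
    -- parameter contributes.
    have e1 : (B x / (P a x : ℂ) * (starRingEnd ℂ) (B x)).im = 0 := by
      rw [div_mul_eq_mul_div, Complex.mul_conj, ← Complex.ofReal_div, Complex.ofReal_im]
    have e2 : h x * ((starRingEnd ℂ) (solCoeff a Complex.I x) * (starRingEnd ℂ) (h x)) =
        (starRingEnd ℂ) (solCoeff a Complex.I x) * ((‖h x‖ ^ 2 : ℝ) : ℂ) := by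
      rw [← Complex.normSq_eq_norm_sq, ← Complex.mul_conj]; ring
    have e3 : ((starRingEnd ℂ) (solCoeff a Complex.I x)).im = -1 := by
      have : solCoeff a Complex.I x = Complex.I - ((2 * (x - sigma a) ^ 2 : ℝ) : ℂ) := by
        rw [solCoeff]; push_cast; ring
      rw [this, map_sub, Complex.conj_ofReal]
      simp [-Complex.ofReal_mul, -Complex.ofReal_pow]
    rw [Complex.add_im, e1, e2, Complex.im_mul_ofReal, e3]
    ring
  · filter_upwards [(isOpen_twoIntervals a).mem_nhds hx] with t ht
    simp only [Function.comp_apply, Pi.mul_apply, Complex.imCLM_apply, Complex.star_def]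
    -- Since `v |B|²` is real, `h B̄` and `A B̄` have the same imaginary part; the latter is
    -- continuous at the singular points.
    rw [H.eq t ht, add_mul, Complex.add_im, mul_assoc, Complex.mul_conj, vFun_eq,
      ← Complex.ofReal_mul, Complex.ofReal_im, add_zero]

theorem continuousOn_energy (H : SolutionData a Complex.I h A B) :
    ContinuousOn (fun y => (A y * (starRingEnd ℂ) (B y)).im) (Icc (a 1) (a 3)) :=
  Complex.continuous_im.comp_continuousOn
    (H.contA.mul (Complex.continuous_conj.comp_continuousOn H.contB))

theorem antitoneOn_energy (H : SolutionData a Complex.I h A B) (ha : StrictMono a) :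
    AntitoneOn (fun y => (A y * (starRingEnd ℂ) (B y)).im) (Icc (a 1) (a 3)) := by
  have h12 : a 1 < a 2 := ha (by decide)
  have h23 : a 2 < a 3 := ha (by decide)
  have piece : ∀ p q, p < q → Ioo p q ⊆ twoIntervals a → Icc p q ⊆ Icc (a 1) (a 3) →
      AntitoneOn (fun y => (A y * (starRingEnd ℂ) (B y)).im) (Icc p q) := by
    intro p q hpq h1 h2
    refine antitoneOn_of_deriv_nonpos (convex_Icc p q) (H.continuousOn_energy.mono h2) ?_ ?_
    · intro x hx
      rw [interior_Icc] at hx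
      exact (H.hasDerivAt_energy (h1 hx)).differentiableAt.differentiableWithinAt
    · intro x hx
      rw [interior_Icc] at hx
      rw [(H.hasDerivAt_energy (h1 hx)).deriv]
      simp
  have := (piece _ _ h12 subset_union_left (Icc_subset_Icc_right h23.le)).union_right
    (piece _ _ h23 subset_union_right (Icc_subset_Icc_left h12.le))
    (isGreatest_Icc h12.le) (isLeast_Icc h23.le)
  rwa [Icc_union_Icc_eq_Icc h12.le h23.le] at this

/-- A monotone function with equal end values is constant, so its derivative `-|h|²` is zero. In
applications `B` vanishes at both `p` and `q`. -/
theorem eq_zero_of_energy_eq (H : SolutionData a Complex.I h A B) (ha : StrictMono a) {p q : ℝ}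
    (hp : p ∈ Icc (a 1) (a 3)) (hq : q ∈ Icc (a 1) (a 3))
    (hpq : (A p * (starRingEnd ℂ) (B p)).im = (A q * (starRingEnd ℂ) (B q)).im) {x : ℝ}
    (hx : x ∈ Ioo p q) (hx' : x ∈ twoIntervals a) : h x = 0 := by
  have hanti := H.antitoneOn_energy ha
  have hc : ∀ y ∈ Ioo p q,
      (A y * (starRingEnd ℂ) (B y)).im = (A p * (starRingEnd ℂ) (B p)).im := fun y hy => by
    have hy' : y ∈ Icc (a 1) (a 3) := ⟨hp.1.trans hy.1.le, hy.2.le.trans hq.2⟩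
    exact le_antisymm (hanti hp hy' hy.1.le) (hpq.trans_le (hanti hy' hq hy.2.le))
  have h0 : HasDerivAt (fun y => (A y * (starRingEnd ℂ) (B y)).im) 0 x :=
    (hasDerivAt_const x _).congr_of_eventuallyEq
      (by filter_upwards [isOpen_Ioo.mem_nhds hx] with y hy using hc y hy)
  have := (H.hasDerivAt_energy hx').unique h0
  simpa using this

/-- The quantity estimated is `B'`: `h` grows at most like `v`, so `B'` is `o(|x - aᵢ|^(-1/2))`. -/
theorem tendsto_mul_sqrt (H : SolutionData a z h A B) (ha : StrictMono a) {F : Filter ℝ}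
    {i : Fin 4} (hF : twoIntervals a ∈ F) (hi : a i ∈ Icc (a 1) (a 3)) (hF' : F ≤ 𝓝[≠] (a i)) :
    Tendsto (fun x => ‖solCoeff a z x * h x‖ * √|x - a i|) F (𝓝 0) := by
  have hF0 : F ≤ 𝓝 (a i) := hF'.trans nhdsWithin_le_nhds
  have h1 : Tendsto (fun x : ℝ => ((√|x - a i| : ℝ) : ℂ)) F (𝓝 0) := by
    have : ContinuousAt (fun x : ℝ => ((√|x - a i| : ℝ) : ℂ)) (a i) := by fun_prop
    simpa [ContinuousAt] using this.tendsto.mono_left hF0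
  have h2 : Tendsto (fun x : ℝ => ((vReal a x * √|x - a i| : ℝ) : ℂ)) F (𝓝 0) := by
    simpa [-Complex.ofReal_mul, Function.comp_def] using
      (Complex.continuous_ofReal.tendsto 0).comp ((tendsto_vReal_mul_sqrt ha i).mono_left hF')
  have hA := tendsto_of_continuousOn_Icc ha H.contA hi hF0 hF
  have hB := tendsto_of_continuousOn_Icc ha H.contB hi hF0 hF
  have hc := (continuous_solCoeff a z).continuousAt.tendsto.mono_left hF0
  have h3 := (hc.mul ((hA.mul h1).add (h2.mul hB))).norm
  simp only [mul_zero, zero_mul, add_zero, norm_zero] at h3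
  refine h3.congr' ?_
  filter_upwards [hF] with x hx
  rw [H.eq x hx, vFun_eq]
  have : ‖((√|x - a i| : ℝ) : ℂ)‖ = √|x - a i| := by
    rw [Complex.norm_real, Real.norm_of_nonneg (Real.sqrt_nonneg _)]
  nth_rewrite 3 [← this]
  rw [← norm_mul]
  congr 1
  push_cast
  ring

theorem boundedAlong_of_norm_le_sqrt (H : SolutionData a z h A B) (ha : StrictMono a)
    {F : Filter ℝ} {i : Fin 4} (hF : twoIntervals a ∈ F) (hi : a i ∈ Icc (a 1) (a 3))
    (hF' : F ≤ 𝓝[≠] (a i)) (hB : ∀ᶠ x in F, ‖B x‖ ≤ 2 * √|x - a i|) : BoundedAlong F h := by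
  have hA := (tendsto_of_continuousOn_Icc ha H.contA hi (hF'.trans nhdsWithin_le_nhds) hF).norm
  have hv := ((tendsto_vReal_mul_sqrt ha i).mono_left hF').norm
  refine ⟨‖A (a i)‖ + 1 + 2, ?_⟩
  filter_upwards [hF, hB, hA.eventually_lt_const (lt_add_one _),
    hv.eventually_lt_const (by simp : ‖(0 : ℝ)‖ < 1)] with x hx h1 h2 h3
  rw [H.eq x hx]
  refine (norm_add_le _ _).trans (add_le_add h2.le ?_)
  rw [norm_mul, vFun_eq, Complex.norm_real]
  rw [norm_mul, Real.norm_of_nonneg (Real.sqrt_nonneg _)] at h3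
  calc ‖vReal a x‖ * ‖B x‖ ≤ ‖vReal a x‖ * (2 * √|x - a i|) := by gcongr
    _ = 2 * (‖vReal a x‖ * √|x - a i|) := by ring
    _ ≤ 2 := by linarith

/-- Near `a₂` one has `|B'| ≤ 1/√(x - a₂)`, and integration from `B(a₂) = 0` gives `|B| ≤ 2√(x -
a₂)`. This absorbs the logarithm in `v B`. -/
theorem boundedAlong_left (H : SolutionData a z h A B) (ha : StrictMono a) (hB : B (a 1) = 0) :
    BoundedAlong (𝓝[>] (a 1)) h := by
  have hF := twoIntervals_mem_nhdsGT_left ha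
  have hi := mem_Icc_one ha
  have hF' : 𝓝[>] (a 1) ≤ 𝓝[≠] (a 1) := nhdsWithin_mono _ fun x hx => ne_of_gt (mem_Ioi.1 hx)
  refine H.boundedAlong_of_norm_le_sqrt ha hF hi hF' ?_
  have hev := (H.tendsto_mul_sqrt ha hF hi hF').eventually_lt_const one_pos
  obtain ⟨d, hd, hsub⟩ := mem_nhdsGT_iff_exists_Ioo_subset.1 (hev.and hF)
  have h0 := tendsto_of_continuousOn_Icc ha H.contB hi nhdsWithin_le_nhds hF
  rw [hB] at h0
  filter_upwards [Ioo_mem_nhdsGT hd] with x hx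
  have := norm_le_sqrt_of_deriv_le (K := 1) (fun y hy => H.derivB y (hsub hy).2) h0
    (fun y hy => ?_) hx
  · rwa [abs_of_pos (sub_pos.2 hx.1), ← mul_one (2 : ℝ)]
  · have h1 := (hsub hy).1
    rw [abs_of_pos (sub_pos.2 hy.1)] at h1
    rw [le_div_iff₀ (Real.sqrt_pos.2 (sub_pos.2 hy.1))]
    exact h1.le

theorem boundedAlong_right (H : SolutionData a z h A B) (ha : StrictMono a) (hB : B (a 3) = 0) :
    BoundedAlong (𝓝[<] (a 3)) h := by
  have hF := twoIntervals_mem_nhdsLT_right ha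
  have hi := mem_Icc_three ha
  have hF' : 𝓝[<] (a 3) ≤ 𝓝[≠] (a 3) := nhdsWithin_mono _ fun x hx => ne_of_lt (mem_Iio.1 hx)
  refine H.boundedAlong_of_norm_le_sqrt ha hF hi hF' ?_
  have hev := (H.tendsto_mul_sqrt ha hF hi hF').eventually_lt_const one_pos
  obtain ⟨d, hd, hsub⟩ := mem_nhdsLT_iff_exists_Ioo_subset.1 (hev.and hF)
  have h0 := tendsto_of_continuousOn_Icc ha H.contB hi nhdsWithin_le_nhds hF
  rw [hB] at h0
  filter_upwards [Ioo_mem_nhdsLT hd] with x hx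
  have := norm_le_sqrt_of_deriv_le_left (K := 1) (fun y hy => H.derivB y (hsub hy).2) h0
    (fun y hy => ?_) hx
  · rwa [abs_sub_comm, abs_of_pos (sub_pos.2 hx.2), ← mul_one (2 : ℝ)]
  · have h1 := (hsub hy).1
    rw [abs_sub_comm, abs_of_pos (sub_pos.2 hy.2)] at h1
    rw [le_div_iff₀ (Real.sqrt_pos.2 (sub_pos.2 hy.2))]
    exact h1.le

end SolutionData

/-! ### Existence of solutions with prescribed boundary data. -/

/-- Solutions with prescribed boundary data at `a₂`. -/
theorem exists_solutionData {a : Fin 4 → ℝ} (ha : StrictMono a) (z A₀ B₀ : ℂ) :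
    ∃ h A B, SolutionData a z h A B ∧ A (a 1) = A₀ ∧ B (a 1) = B₀ := by
  have h13 : a 1 < a 3 := ha (by decide)
  -- `N₀`, `N₁`, `N₂` are the constant matrices that multiply `q`, `q v`, `q v²` in the system `A' =
  -- -v q (A + v B)`, `B' = q (A + v B)`.
  let N₀ : ℂ × ℂ →L[ℝ] ℂ × ℂ := (ContinuousLinearMap.inr ℝ ℂ ℂ).comp (.fst ℝ ℂ ℂ)
  let N₁ : ℂ × ℂ →L[ℝ] ℂ × ℂ := (ContinuousLinearMap.inr ℝ ℂ ℂ).comp (.snd ℝ ℂ ℂ) -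
    (ContinuousLinearMap.inl ℝ ℂ ℂ).comp (.fst ℝ ℂ ℂ)
  let N₂ : ℂ × ℂ →L[ℝ] ℂ × ℂ := -(ContinuousLinearMap.inl ℝ ℂ ℂ).comp (.snd ℝ ℂ ℂ)
  let M : ℝ → ℂ × ℂ →L[ℝ] ℂ × ℂ := fun x => solCoeff a z x • N₀ +
    (solCoeff a z x * vFun a x) • N₁ + (solCoeff a z x * (vFun a x * vFun a x)) • N₂
  have hM : ∀ x Y, M x Y = (-(vFun a x * (solCoeff a z x * (Y.1 + vFun a x * Y.2))),
      solCoeff a z x * (Y.1 + vFun a x * Y.2)) := fun x Y => by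
    ext <;> simp [M, N₀, N₁, N₂] <;> ring
  have hcont : ∀ x ∈ Ioo (a 1) (a 3) \ {a 2}, ContinuousAt M x := fun x hx => by
    have hv := (hasDerivAt_vFun ha (twoIntervals_ne ha (mem_twoIntervals hx.1 hx.2))).continuousAt
    have hc := (continuous_solCoeff a z).continuousAt (x := x)
    exact ((hc.smul continuousAt_const).add ((hc.mul hv).smul continuousAt_const)).add
      ((hc.mul (hv.mul hv)).smul continuousAt_const)
  have hint : IntervalIntegrable M volume (a 1) (a 3) := by
    have hc : ContinuousOn (solCoeff a z) (uIcc (a 1) (a 3)) :=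
      (continuous_solCoeff a z).continuousOn
    have hv := memLp_vFun a (a 1) (a 3)
    have h1 : IntervalIntegrable (vFun a) volume (a 1) (a 3) :=
      (intervalIntegrable_iff_integrableOn_Ioo_of_le h13.le).2 (hv.integrable one_le_two)
    -- Square-integrability of `v` is used here: the worst coefficient of the system is `q v²`.
    have h2 := intervalIntegrable_mul h13.le hv hv
    have k0 := hc.intervalIntegrable (μ := volume)
    have k1 := h1.continuousOn_mul hc
    have k2 := h2.continuousOn_mul hc
    rw [intervalIntegrable_iff] at *
    exact ((k0.smul_const N₀).add (k1.smul_const N₁)).add (k2.smul_const N₂)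
  obtain ⟨Y, hYc, hY0, hYd⟩ := exists_linear_ode_solution h13 (countable_singleton (a 2)) hcont
    hint (A₀, B₀)
  have hd : ∀ x ∈ twoIntervals a, HasDerivAt Y (M x (Y x)) x := fun x hx =>
    hYd x ⟨twoIntervals_subset ha hx, twoIntervals_ne ha hx 2⟩
  refine ⟨fun x => (Y x).1 + vFun a x * (Y x).2, fun x => (Y x).1, fun x => (Y x).2,
    ⟨⟨hYc.fst, hYc.snd, fun _ _ => rfl, fun x hx => ?_⟩, fun x hx => ?_⟩, by simp [hY0],
    by simp [hY0]⟩
  · have h1 := (hd x hx)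
    rw [hM] at h1
    have hv := hasDerivAt_vFun ha (twoIntervals_ne ha hx)
    have k1 : HasDerivAt (fun x => (Y x).1) _ x := h1.fst
    have k2 : HasDerivAt (fun x => (Y x).2) _ x := h1.snd
    refine (k1.add (hv.mul k2)).congr_deriv ?_
    dsimp only
    ring
  · have h1 := (hd x hx)
    rw [hM] at h1
    exact h1.snd

theorem BoundaryData.lincomb {a : Fin 4 → ℝ} {h₁ A₁ B₁ h₂ A₂ B₂ : ℝ → ℂ}
    (H₁ : BoundaryData a h₁ A₁ B₁) (H₂ : BoundaryData a h₂ A₂ B₂) (k l : ℂ) :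
    BoundaryData a (fun x => k * h₁ x + l * h₂ x) (fun x => k * A₁ x + l * A₂ x)
      (fun x => k * B₁ x + l * B₂ x) where
  contA := (H₁.contA.const_mul k).add (H₂.contA.const_mul l)
  contB := (H₁.contB.const_mul k).add (H₂.contB.const_mul l)
  eq x hx := by rw [H₁.eq x hx, H₂.eq x hx]; ring
  deriv x hx := (((H₁.deriv x hx).const_mul k).add ((H₂.deriv x hx).const_mul l)).congr_deriv
    (by ring)

theorem SolutionData.lincomb {a : Fin 4 → ℝ} {z : ℂ} {h₁ A₁ B₁ h₂ A₂ B₂ : ℝ → ℂ}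
    (H₁ : SolutionData a z h₁ A₁ B₁) (H₂ : SolutionData a z h₂ A₂ B₂) (k l : ℂ) :
    SolutionData a z (fun x => k * h₁ x + l * h₂ x) (fun x => k * A₁ x + l * A₂ x)
      (fun x => k * B₁ x + l * B₂ x) where
  toBoundaryData := H₁.toBoundaryData.lincomb H₂.toBoundaryData k l
  derivB x hx := (((H₁.derivB x hx).const_mul k).add ((H₂.derivB x hx).const_mul l)).congr_deriv
    (by ring)

/-- A nontrivial solution with `[h, u](a₄⁻) = 0`. -/
theorem exists_solutionData_right {a : Fin 4 → ℝ} (ha : StrictMono a) (z : ℂ) :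
    ∃ h A B, SolutionData a z h A B ∧ A (a 3) = 1 ∧ B (a 3) = 0 := by
  obtain ⟨h₁, A₁, B₁, H₁, hA₁, hB₁⟩ := exists_solutionData ha z 1 0
  obtain ⟨h₂, A₂, B₂, H₂, hA₂, hB₂⟩ := exists_solutionData ha z 0 1
  have hW := H₁.wronskian_eq H₂ (mem_Icc_three ha)
  rw [hA₁, hB₁, hA₂, hB₂] at hW
  -- This combination cancels `B` at `a₄`, and its `A` there is the Wronskian, which equals 1 by the
  -- data at `a₂`.
  refine ⟨_, _, _, H₁.lincomb H₂ (B₂ (a 3)) (-B₁ (a 3)), ?_, ?_⟩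
  · linear_combination hW
  · ring

/-! ### From solutions to boundary data; injectivity of `L_S - i`. -/

theorem exists_continuousOn_extension {a : Fin 4 → ℝ} (ha : StrictMono a) {f f' : ℝ → ℂ}
    (hf : ∀ x ∈ twoIntervals a, HasDerivAt f (f' x) x) (hf' : Integrable f' (mu a))
    (h2 : ∃ l, Tendsto f (𝓝[<] (a 2)) (𝓝 l) ∧ Tendsto f (𝓝[>] (a 2)) (𝓝 l)) :
    ∃ F : ℝ → ℂ, ContinuousOn F (Icc (a 1) (a 3)) ∧ EqOn F f (twoIntervals a) := by
  have h12 : a 1 < a 2 := ha (by decide)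
  have h23 : a 2 < a 3 := ha (by decide)
  have hc : ContinuousOn f (twoIntervals a) := fun x hx => (hf x hx).continuousAt.continuousWithinAt
  obtain ⟨⟨l₁, hl₁⟩, -⟩ := exists_tendsto_endpoints h12 (fun x hx => hf x (Or.inl hx))
    (IntegrableOn.mono_set hf' (Ioo_subset_Ioo_right h23.le))
  obtain ⟨-, ⟨l₃, hl₃⟩⟩ := exists_tendsto_endpoints h23 (fun x hx => hf x (Or.inr hx))
    (IntegrableOn.mono_set hf' (Ioo_subset_Ioo_left h12.le))
  obtain ⟨l₂, hl, hr⟩ := h2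
  refine ⟨extendFrom (twoIntervals a) f, continuousOn_extendFrom (closure_twoIntervals ha).ge ?_,
    fun x hx => extendFrom_extends hc x hx⟩
  intro x hx
  by_cases h1 : x = a 1
  · subst h1
    exact ⟨l₁, hl₁.mono_left (nhdsWithin_mono _ fun y hy => (twoIntervals_subset ha hy).1)⟩
  by_cases h3 : x = a 3
  · subst h3
    exact ⟨l₃, hl₃.mono_left (nhdsWithin_mono _ fun y hy => (twoIntervals_subset ha hy).2)⟩
  by_cases h2 : x = a 2
  · subst h2
    refine ⟨l₂, (hl.sup hr).mono_left ?_⟩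
    rw [← nhdsWithin_union, Iio_union_Ioi]
    exact nhdsWithin_mono _ fun y hy => twoIntervals_ne ha hy 2
  · exact ⟨_, hc x (mem_twoIntervals
      ⟨lt_of_le_of_ne hx.1 (Ne.symm h1), lt_of_le_of_ne hx.2 h3⟩ h2)⟩

/-- A square-integrable solution that satisfies the transmission conditions has boundary data. -/
theorem IsSolution.exists_solutionData {a : Fin 4 → ℝ} (ha : StrictMono a) {z : ℂ} {h : ℝ → ℂ}
    (hs : IsSolution a z h) (hL : MemLp h 2 (mu a)) (hu : Transmits a h uFun)
    (hv : Transmits a h (vFun a)) : ∃ A B, SolutionData a z h A B := by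
  have hdB : ∀ x ∈ twoIntervals a, HasDerivAt (quasiDeriv a h) (solCoeff a z x * h x) x :=
    fun x hx => by
      obtain ⟨-, h2, h3⟩ := hs x hx
      exact h2.hasDerivAt.congr_deriv ((L_eq_iff _ _ _ _).1 h3)
  have hdh : ∀ x ∈ twoIntervals a, HasDerivAt h (quasiDeriv a h x / (P a x : ℂ)) x := fun x hx => by
    refine (hs x hx).1.hasDerivAt.congr_deriv ?_
    rw [quasiDeriv, mul_div_cancel_left₀ _ (P_cast_ne_zero ha hx)]
  -- By `P v' = 1` the term `v' B` cancels `h'`. What remains is a product of two `L²` functions,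
  -- hence integrable.
  have hdA : ∀ x ∈ twoIntervals a, HasDerivAt (fun x => h x - vFun a x * quasiDeriv a h x)
      (-(vFun a x * (solCoeff a z x * h x))) x := fun x hx => by
    refine ((hdh x hx).sub ((hasDerivAt_vFun ha (twoIntervals_ne ha hx)).mul
      (hdB x hx))).congr_deriv ?_
    ring
  have hg : MemLp (fun x => solCoeff a z x * h x) 2 (mu a) := by
    obtain ⟨C, hC⟩ := isCompact_Icc.exists_bound_of_continuousOn
      (continuous_solCoeff a z).continuousOn (s := Icc (a 1) (a 3))
    refine MemLp.of_le_mul (c := C) hL ((continuous_solCoeff a z).aestronglyMeasurable.mul hL.1)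
      ((ae_restrict_iff' measurableSet_Ioo).2 (Eventually.of_forall fun x hx => ?_))
    rw [norm_mul]
    gcongr
    exact hC x (Ioo_subset_Icc_self hx)
  obtain ⟨B, hBc, hB⟩ := exists_continuousOn_extension ha hdB (hg.integrable one_le_two) (by
    obtain ⟨l, h1, h2⟩ := hu
    refine ⟨-l, h1.neg.congr fun x => ?_, h2.neg.congr fun x => ?_⟩ <;> simp [lagrange_uFun])
  obtain ⟨A, hAc, hA⟩ := exists_continuousOn_extension ha hdA
    (((memLp_vFun a _ _).integrable_mul hg).neg) (by
    obtain ⟨l, h1, h2⟩ := hv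
    refine ⟨l, h1.congr' ?_, h2.congr' ?_⟩
    · filter_upwards [twoIntervals_mem_nhdsLT_mid ha] with x hx
      exact lagrange_vFun ha h (twoIntervals_ne ha hx)
    · filter_upwards [twoIntervals_mem_nhdsGT_mid ha] with x hx
      exact lagrange_vFun ha h (twoIntervals_ne ha hx))
  refine ⟨A, B, ⟨hAc, hBc, fun x hx => ?_, fun x hx => ?_⟩, fun x hx => ?_⟩
  · rw [hA hx, hB hx]; ring
  · rw [hB hx]; exact hdh x hx
  · exact (hdB x hx).congr_of_eventuallyEq
      (hB.eventuallyEq_of_mem ((isOpen_twoIntervals a).mem_nhds hx))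

theorem memLp_mu_of {a : Fin 4 → ℝ} {h : ℝ → ℂ}
    (h1 : MemLp h 2 (volume.restrict (Ioo (a 1) (a 2))))
    (h2 : MemLp h 2 (volume.restrict (Ioo (a 2) (a 3)))) : MemLp h 2 (mu a) := by
  have hm : mu a ≤ volume.restrict (twoIntervals a) := by
    have : mu a = (mu a).restrict (twoIntervals a) :=
      (Measure.restrict_eq_self_of_ae_mem (ae_mem_twoIntervals a)).symm
    rw [this]
    exact Measure.restrict_mono_measure Measure.restrict_le_self _
  have hms : AEStronglyMeasurable h (volume.restrict (twoIntervals a)) :=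
    aestronglyMeasurable_union_iff.2 ⟨h1.1, h2.1⟩
  refine MemLp.mono_measure hm ((memLp_two_iff_integrable_sq_norm hms).2 ?_)
  exact IntegrableOn.union ((memLp_two_iff_integrable_sq_norm h1.1).1 h1)
    ((memLp_two_iff_integrable_sq_norm h2.1).1 h2)

/-- `L_S - i` is injective. -/
theorem InDomainLS.eq_zero {a : Fin 4 → ℝ} (ha : StrictMono a) {ψ : ℝ → ℂ} (hψ : InDomainLS a ψ)
    (h : ∀ᵐ x ∂(mu a), L a ψ x = Complex.I * ψ x) : ∀ x ∈ twoIntervals a, ψ x = 0 := by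
  have h12 : a 1 < a 2 := ha (by decide)
  have h23 : a 2 < a 3 := ha (by decide)
  -- The equation is known only almost everywhere; since `P ψ'` is locally absolutely continuous and
  -- the right side is continuous, it holds at every point.
  have piece : ∀ c d, Ioo c d ⊆ twoIntervals a → MaxDomainOn a c d ψ → ∀ x ∈ Ioo c d,
      HasDerivAt (quasiDeriv a ψ) (solCoeff a Complex.I x * ψ x) x := by
    intro c d hs H
    refine H.ac_quasi.hasDerivAt_of_ae ((continuous_solCoeff _ _).continuousOn.mul fun x hx =>
      (H.diff x hx).continuousAt.continuousWithinAt) ?_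
    filter_upwards [H.ac_quasi.ae_differentiableAt, ae_imp_of_ae_restrict h] with x h1 h2 hx
    exact (h1 hx).hasDerivAt.congr_deriv
      ((L_eq_iff _ _ _ _).1 (h2 (twoIntervals_subset ha (hs hx))))
  have hd : ∀ x ∈ twoIntervals a, HasDerivAt (quasiDeriv a ψ) (solCoeff a Complex.I x * ψ x) x :=
    fun x hx => hx.elim (piece _ _ subset_union_left hψ.left x)
      (piece _ _ subset_union_right hψ.right x)
  have hs : IsSolution a Complex.I ψ := fun x hx =>
    ⟨hx.elim (hψ.left.diff x) (hψ.right.diff x), (hd x hx).differentiableAt,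
      (L_eq_iff _ _ _ _).2 (hd x hx).deriv⟩
  obtain ⟨A, B, H⟩ := hs.exists_solutionData ha (memLp_mu_of hψ.left.memLp hψ.right.memLp)
    hψ.trans_u hψ.trans_v
  have hB1 : B (a 1) = 0 := by
    simpa using tendsto_nhds_unique (H.tendsto_lagrange_uFun ha (mem_Icc_one ha)
      nhdsWithin_le_nhds (twoIntervals_mem_nhdsGT_left ha)) hψ.bc_left
  have hB3 : B (a 3) = 0 := by
    simpa using tendsto_nhds_unique (H.tendsto_lagrange_uFun ha (mem_Icc_three ha)
      nhdsWithin_le_nhds (twoIntervals_mem_nhdsLT_right ha)) hψ.bc_right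
  intro x hx
  exact H.eq_zero_of_energy_eq ha (mem_Icc_one ha) (mem_Icc_three ha) (by simp [hB1, hB3])
    (twoIntervals_subset ha hx) hx

/-! ### Variation of parameters. -/

theorem ACloc.mul {f g : ℝ → ℂ} {s : Set ℝ} (hf : ACloc f s) (hg : ACloc g s) :
    ACloc (fun x => f x * g x) s := fun c d h => (hf c d h).smul (hg c d h)

section GreenOperator

variable {a : Fin 4 → ℝ} {z : ℂ} {h₁ A₁ B₁ h₂ A₂ B₂ f : ℝ → ℂ}

theorem ACloc_primitive {c d p q r : ℝ} {g : ℝ → ℂ} (hg : IntervalIntegrable g volume p q)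
    (hr : r ∈ Icc p q) (hs : Ioo c d ⊆ Icc p q) : ACloc (fun x => ∫ t in r..x, g t) (Ioo c d) := by
  intro y w hyw
  have hpq := hr.1.trans hr.2
  exact (hg.absolutelyContinuousOnInterval_primitive (by rwa [uIcc_of_le hpq])).mono
    ((hyw.trans hs).trans_eq (uIcc_of_le hpq).symm)

/-- Variation of parameters. -/
theorem inDomainLS_green (ha : StrictMono a) (H₁ : SolutionData a z h₁ A₁ B₁)
    (H₂ : SolutionData a z h₂ A₂ B₂) (hB₁ : B₁ (a 1) = 0) (hB₂ : B₂ (a 3) = 0) {W : ℂ}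
    (hW : ∀ x ∈ Icc (a 1) (a 3), A₁ x * B₂ x - A₂ x * B₁ x = W) (hW0 : W ≠ 0)
    (hf : MemLp f 2 (mu a)) {ψ : ℝ → ℂ} (hψ : ∀ x, ψ x = W⁻¹ *
      (h₂ x * (∫ t in (a 1)..x, h₁ t * f t) - h₁ x * ∫ t in (a 3)..x, h₂ t * f t)) :
    InDomainLS a ψ ∧ ∀ᵐ x ∂(mu a), L a ψ x = z * ψ x + f x := by
  have h12 : a 1 < a 2 := ha (by decide)
  have h23 : a 2 < a 3 := ha (by decide)
  have h13 : a 1 ≤ a 3 := (h12.trans h23).le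
  have i₁ := intervalIntegrable_mul h13 H₁.memLp hf
  have i₂ := intervalIntegrable_mul h13 H₂.memLp hf
  set F₁ : ℝ → ℂ := fun x => ∫ t in (a 1)..x, h₁ t * f t with hF₁
  set F₂ : ℝ → ℂ := fun x => ∫ t in (a 3)..x, h₂ t * f t with hF₂
  have c₁ : ContinuousOn F₁ (Icc (a 1) (a 3)) :=
    continuousOn_primitive_mul h13 H₁.memLp hf (mem_Icc_one ha)
  have c₂ : ContinuousOn F₂ (Icc (a 1) (a 3)) :=
    continuousOn_primitive_mul h13 H₂.memLp hf (mem_Icc_three ha)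
  set Aψ : ℝ → ℂ := fun x => W⁻¹ * (A₂ x * F₁ x - A₁ x * F₂ x) with hAψ
  set Bψ : ℝ → ℂ := fun x => W⁻¹ * (B₂ x * F₁ x - B₁ x * F₂ x) with hBψ
  have cA : ContinuousOn Aψ (Icc (a 1) (a 3)) :=
    ((H₂.contA.mul c₁).sub (H₁.contA.mul c₂)).const_mul _
  have cB : ContinuousOn Bψ (Icc (a 1) (a 3)) :=
    ((H₂.contB.mul c₁).sub (H₁.contB.mul c₂)).const_mul _
  have hsubI : twoIntervals a ⊆ Icc (a 1) (a 3) := (twoIntervals_subset ha).trans Ioo_subset_Icc_self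
  have dF : ∀ᵐ x, x ∈ Ioo (a 1) (a 3) →
      HasDerivAt F₁ (h₁ x * f x) x ∧ HasDerivAt F₂ (h₂ x * f x) x := by
    filter_upwards [i₁.ae_hasDerivAt_integral, i₂.ae_hasDerivAt_integral] with x k1 k2 hx
    rw [uIcc_of_le h13] at k1 k2
    have hx' := Ioo_subset_Icc_self hx
    exact ⟨k1 hx' _ (mem_Icc_one ha), k2 hx' _ (mem_Icc_three ha)⟩
  have eψ : ∀ x, ψ x = W⁻¹ * (h₂ x * F₁ x - h₁ x * F₂ x) := hψ
  have dψ : ∀ᵐ x, x ∈ twoIntervals a → HasDerivAt ψ (Bψ x / (P a x : ℂ)) x := by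
    filter_upwards [dF] with x k hx
    obtain ⟨k1, k2⟩ := k (twoIntervals_subset ha hx)
    rw [show ψ = fun x => W⁻¹ * (h₂ x * F₁ x - h₁ x * F₂ x) from funext eψ]
    -- The contributions `h₂h₁f` and `h₁h₂f` from the primitives cancel.
    refine ((((H₂.deriv x hx).mul k1).sub ((H₁.deriv x hx).mul k2)).const_mul W⁻¹).congr_deriv ?_
    simp only [hBψ]
    ring
  have dB : ∀ᵐ x, x ∈ twoIntervals a → HasDerivAt Bψ (solCoeff a z x * ψ x + f x) x := by
    filter_upwards [dF] with x k hx
    obtain ⟨k1, k2⟩ := k (twoIntervals_subset ha hx)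
    refine ((((H₂.derivB x hx).mul k1).sub ((H₁.derivB x hx).mul k2)).const_mul W⁻¹).congr_deriv ?_
    -- For `Bψ` the primitives contribute the Wronskian times `f/W`, which is the source term `f`.
    have hw : B₂ x * h₁ x - B₁ x * h₂ x = W := by
      rw [← hW x (hsubI hx), H₁.eq x hx, H₂.eq x hx]; ring
    rw [eψ]
    have : W⁻¹ * W = 1 := inv_mul_cancel₀ hW0
    linear_combination f x * this + W⁻¹ * f x * hw
  have acB : ∀ c d, Ioo c d ⊆ twoIntervals a → ACloc Bψ (Ioo c d) ∧ ACloc ψ (Ioo c d) := by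
    intro c d hs
    have hsI := hs.trans hsubI
    have p₁ := ACloc_primitive i₁ (mem_Icc_one ha) hsI
    have p₂ := ACloc_primitive i₂ (mem_Icc_three ha) hsI
    have cont : ∀ {h A B : ℝ → ℂ}, SolutionData a z h A B → ACloc h (Ioo c d) ∧
        ACloc B (Ioo c d) := fun {h A B} H => by
      refine ⟨ACloc_of_hasDerivAt (fun x hx => H.deriv x (hs hx)) ?_,
        ACloc_of_hasDerivAt (fun x hx => H.derivB x (hs hx)) ?_⟩
      · exact (H.contB.mono hsI).div
          (Complex.continuous_ofReal.comp (continuous_P a)).continuousOn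
          fun x hx => P_cast_ne_zero ha (hs hx)
      · exact (continuous_solCoeff a z).continuousOn.mul fun x hx =>
          (H.deriv x (hs hx)).continuousAt.continuousWithinAt
    constructor
    · refine ((((cont H₂).2.mul p₁).add (((cont H₁).2.mul p₂).smul (-1))).smul W⁻¹).congr ?_
      intro x _
      simp only [hBψ, Pi.smul_apply, Pi.add_apply, smul_eq_mul]
      ring
    · refine ((((cont H₂).1.mul p₁).add (((cont H₁).1.mul p₂).smul (-1))).smul W⁻¹).congr ?_
      intro x _
      simp only [eψ, Pi.smul_apply, Pi.add_apply, smul_eq_mul]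
      ring
  have dψ' : ∀ c d, Ioo c d ⊆ twoIntervals a → ∀ x ∈ Ioo c d,
      HasDerivAt ψ (Bψ x / (P a x : ℂ)) x := fun c d hs => by
    refine (acB c d hs).2.hasDerivAt_of_ae ?_ ?_
    · exact (cB.mono (hs.trans hsubI)).div
        (Complex.continuous_ofReal.comp (continuous_P a)).continuousOn
        fun x hx => P_cast_ne_zero ha (hs hx)
    · filter_upwards [dψ] with x hx hxm using hx (hs hxm)
  have H : BoundaryData a ψ Aψ Bψ := by
    refine ⟨cA, cB, fun x hx => ?_, fun x hx => ?_⟩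
    · rw [eψ, H₁.eq x hx, H₂.eq x hx]
      simp only [hAψ, hBψ]
      ring
    · exact hx.elim (dψ' _ _ subset_union_left x) (dψ' _ _ subset_union_right x)
  have hL : ∀ᵐ x ∂(mu a), L a ψ x = z * ψ x + f x := by
    have hm : ∀ᵐ x, x ∈ twoIntervals a → L a ψ x = z * ψ x + f x := by
      filter_upwards [dB] with x k hx
      have he : quasiDeriv a ψ =ᶠ[𝓝 x] Bψ := by
        filter_upwards [(isOpen_twoIntervals a).mem_nhds hx] with y hy using H.quasiDeriv_eq ha hy
      rw [L, ((k hx).congr_of_eventuallyEq he).deriv, solCoeff]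
      ring
    filter_upwards [ae_restrict_of_ae hm, ae_mem_twoIntervals a] with x h1 h2 using h1 h2
  have maxDom : ∀ c d, Ioo c d ⊆ twoIntervals a → MaxDomainOn a c d ψ := by
    intro c d hs
    have hμ : volume.restrict (Ioo c d) ≤ mu a :=
      Measure.restrict_mono (hs.trans (twoIntervals_subset ha)) le_rfl
    refine ⟨(acB c d hs).2, fun x hx => (dψ' c d hs x hx).differentiableAt,
      (acB c d hs).1.congr fun x hx => (H.quasiDeriv_eq ha (hs hx)).symm,
      H.memLp.mono_measure hμ, MemLp.mono_measure hμ ?_⟩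
    exact ((H.memLp.const_mul z).add hf).ae_eq (by filter_upwards [hL] with x hx using hx.symm)
  refine ⟨⟨maxDom _ _ subset_union_left, maxDom _ _ subset_union_right, ?_, ?_,
    H.transmits_uFun ha, H.transmits_vFun ha⟩, hL⟩
  -- At `a₂` both terms of `Bψ` vanish: one because its primitive starts there, the other because
  -- `B₁(a₂) = 0`. The end `a₄` is symmetric.
  · have := H.tendsto_lagrange_uFun ha (mem_Icc_one ha) nhdsWithin_le_nhds
      (twoIntervals_mem_nhdsGT_left ha)
    simpa [hBψ, hF₁, hB₁] using this
  · have := H.tendsto_lagrange_uFun ha (mem_Icc_three ha) nhdsWithin_le_nhds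
      (twoIntervals_mem_nhdsLT_right ha)
    simpa [hBψ, hF₂, hB₂] using this

end GreenOperator

/-! ### Normal form of an arbitrary Green's function. -/

theorem memLp_of_log_growth {c d : ℝ} {h : ℝ → ℂ} (hcd : c < d) (hh : ContinuousOn h (Ioo c d))
    (h1 : ∃ C : ℝ, ∀ᶠ x in 𝓝[>] c, ‖h x‖ ≤ C * (1 + |Real.log (|x - c|)|))
    (h2 : ∃ C : ℝ, ∀ᶠ x in 𝓝[<] d, ‖h x‖ ≤ C * (1 + |Real.log (|x - d|)|)) :
    MemLp h 2 (volume.restrict (Ioo c d)) := by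
  obtain ⟨C, hC⟩ := h1
  obtain ⟨D, hD⟩ := h2
  obtain ⟨p, hp, hpC⟩ : ∃ p > c, ∀ x ∈ Ioo c p, ‖h x‖ ≤ C * (1 + |Real.log (|x - c|)|) :=
    mem_nhdsGT_iff_exists_Ioo_subset.1 hC
  obtain ⟨q, hq, hqD⟩ : ∃ q < d, ∀ x ∈ Ioo q d, ‖h x‖ ≤ D * (1 + |Real.log (|x - d|)|) :=
    mem_nhdsLT_iff_exists_Ioo_subset.1 hD
  obtain ⟨p', hp', hpp⟩ := exists_between (lt_min hp hcd : c < min p d)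
  obtain ⟨q', hqq, hq'⟩ := exists_between (max_lt hq hcd : max q c < d)
  obtain ⟨E, hE⟩ := isCompact_Icc.exists_bound_of_continuousOn
    (hh.mono (Icc_subset_Ioo hp' hq') : ContinuousOn h (Icc p' q'))
  have k0 : MemLp (fun _ : ℝ => (1 : ℝ)) 2 (volume.restrict (Ioo c d)) := memLp_const 1
  have k1 : MemLp (fun x => |Real.log (|x - c|)|) 2 (volume.restrict (Ioo c d)) :=
    (memLp_log c c d).norm
  have k2 : MemLp (fun x => |Real.log (|x - d|)|) 2 (volume.restrict (Ioo c d)) :=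
    (memLp_log d c d).norm
  have hg : MemLp (fun x => 1 + |Real.log (|x - c|)| + |Real.log (|x - d|)|) 2
      (volume.restrict (Ioo c d)) :=
    (k0.add k1).add k2
  refine MemLp.of_le_mul (c := |C| + |D| + |E|) hg (hh.aestronglyMeasurable measurableSet_Ioo)
    ((ae_restrict_iff' measurableSet_Ioo).2 (Eventually.of_forall fun x hx => ?_))
  have key : ‖h x‖ ≤ C * (1 + |Real.log (|x - c|)|) ∨ ‖h x‖ ≤ D * (1 + |Real.log (|x - d|)|) ∨
      ‖h x‖ ≤ E := by
    rcases lt_or_ge x p' with hxp | hxp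
    · exact Or.inl (hpC x ⟨hx.1, hxp.trans (hpp.trans_le (min_le_left _ _))⟩)
    rcases lt_or_ge q' x with hxq | hxq
    · exact Or.inr (Or.inl (hqD x ⟨(le_max_left _ _).trans_lt (hqq.trans hxq), hx.2⟩))
    · exact Or.inr (Or.inr (hE x ⟨hxp, hxq⟩))
  have n1 := abs_nonneg (Real.log (|x - c|))
  have n2 := abs_nonneg (Real.log (|x - d|))
  rw [Real.norm_of_nonneg (add_nonneg (add_nonneg zero_le_one n1) n2)]
  generalize |Real.log (|x - c|)| = r at *
  generalize |Real.log (|x - d|)| = s at *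
  have hC' := abs_nonneg C
  have hD' := abs_nonneg D
  have hE' := abs_nonneg E
  have mono : ∀ k t : ℝ, k ≤ |C| + |D| + |E| → 0 ≤ t → t ≤ 1 + r + s →
      k * t ≤ (|C| + |D| + |E|) * (1 + r + s) := fun k t h1 h2 h3 =>
    (mul_le_mul_of_nonneg_right h1 h2).trans (mul_le_mul_of_nonneg_left h3 (by positivity))
  rcases key with k | k | k
  · exact k.trans (mono C _ (by linarith [le_abs_self C]) (by linarith) (by linarith))
  · exact k.trans (mono D _ (by linarith [le_abs_self D]) (by linarith) (by linarith))
  · exact k.trans ((mul_one E).ge.trans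
      (mono E 1 (by linarith [le_abs_self E]) zero_le_one (by linarith)))

theorem BoundedAlong.log_growth {F : Filter ℝ} {h : ℝ → ℂ} (H : BoundedAlong F h) (c : ℝ) :
    ∃ C : ℝ, ∀ᶠ x in F, ‖h x‖ ≤ C * (1 + |Real.log (|x - c|)|) := by
  obtain ⟨C, hC⟩ := H
  refine ⟨|C|, hC.mono fun x hx => ?_⟩
  nlinarith [le_abs_self C, mul_nonneg (abs_nonneg C) (abs_nonneg (Real.log |x - c|))]

theorem LogarithmicAlong.log_growth {F : Filter ℝ} {c : ℝ} {h : ℝ → ℂ} (hF : F ≤ 𝓝 c)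
    (H : LogarithmicAlong F c h) :
    ∃ C : ℝ, ∀ᶠ x in F, ‖h x‖ ≤ C * (1 + |Real.log (|x - c|)|) := by
  obtain ⟨f, g, hf, hg, -, h⟩ := H
  refine ⟨(‖f c‖ + 1) + (‖g c‖ + 1), ?_⟩
  filter_upwards [h, (hf.norm.tendsto.mono_left hF).eventually_lt_const (lt_add_one _),
    (hg.norm.tendsto.mono_left hF).eventually_lt_const (lt_add_one _)] with x hx h1 h2
  rw [hx]
  refine (norm_add_le _ _).trans ?_
  rw [norm_mul, Complex.norm_real, Real.norm_eq_abs]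
  nlinarith [abs_nonneg (Real.log |x - c|), norm_nonneg (f c), norm_nonneg (g c),
    mul_le_mul_of_nonneg_right h2.le (abs_nonneg (Real.log |x - c|)),
    mul_nonneg (norm_nonneg (f c)) (abs_nonneg (Real.log |x - c|))]

theorem LogarithmicAlong.not_eventually_zero {F : Filter ℝ} [F.NeBot] {c : ℝ} {h : ℝ → ℂ}
    (hF : F ≤ 𝓝[≠] c) (H : LogarithmicAlong F c h) (h0 : ∀ᶠ x in F, h x = 0) : False := by
  obtain ⟨f, g, hf, hg, hgc, h⟩ := H
  have hF' := hF.trans nhdsWithin_le_nhds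
  have hlog : Tendsto (fun x : ℝ => |Real.log (|x - c|)|) F atTop :=
    (tendsto_abs_atBot_atTop.comp
      (Real.tendsto_log_nhdsGT_zero.comp (tendsto_abs_sub_nhdsGT c))).mono_left hF
  have h1 := (hg.norm.tendsto.mono_left hF').pos_mul_atTop (norm_pos_iff.2 hgc) hlog
  obtain ⟨x, k1, k2, k3, k4⟩ := (h0.and (h.and
    (((hf.norm.tendsto.mono_left hF').eventually_lt_const (lt_add_one _)).and
      (h1.eventually_ge_atTop (‖f c‖ + 1))))).exists
  rw [k1] at k2
  have : ‖g x‖ * |Real.log (|x - c|)| = ‖f x‖ := by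
    rw [← norm_neg (f x), eq_neg_of_add_eq_zero_right (a := f x)
      (b := g x * (Real.log |x - c| : ℂ)) k2.symm |>.symm, norm_mul, Complex.norm_real,
      Real.norm_eq_abs]
  linarith

/-- Otherwise `v B` would be unbounded, as `|v|` tends to infinity, while `h - A` is bounded. -/
theorem BoundaryData.eq_zero_of_boundedAlong {a : Fin 4 → ℝ} {h A B : ℝ → ℂ}
    (H : BoundaryData a h A B) (ha : StrictMono a) {F : Filter ℝ} [F.NeBot] {i : Fin 4}
    (hF : twoIntervals a ∈ F) (hi : a i ∈ Icc (a 1) (a 3)) (hF' : F ≤ 𝓝[≠] (a i))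
    (hb : BoundedAlong F h) : B (a i) = 0 := by
  by_contra hne
  obtain ⟨C, hC⟩ := hb
  have hF0 := hF'.trans nhdsWithin_le_nhds
  have hA := (tendsto_of_continuousOn_Icc ha H.contA hi hF0 hF).norm
  have hB := (tendsto_of_continuousOn_Icc ha H.contB hi hF0 hF).norm
  have h1 := hB.pos_mul_atTop (norm_pos_iff.2 hne) ((tendsto_abs_vReal ha i).mono_left hF')
  have hF1 : ∀ᶠ x in F, x ∈ twoIntervals a := hF
  obtain ⟨x, k1, k2, k3, k4⟩ := (hF1.and (hC.and ((hA.eventually_lt_const (lt_add_one _)).and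
      (h1.eventually_ge_atTop (‖A (a i)‖ + 1 + C))))).exists
  have e : vFun a x * B x = h x - A x := by rw [H.eq x k1]; ring
  have e' : ‖B x‖ * |vReal a x| = ‖h x - A x‖ := by
    rw [← e, norm_mul, vFun_eq, Complex.norm_real, Real.norm_eq_abs, mul_comm]
  linarith [norm_sub_le (h x) (A x)]

theorem IsSolution.continuousOn {a : Fin 4 → ℝ} {z : ℂ} {h : ℝ → ℂ} (hs : IsSolution a z h) :
    ContinuousOn h (twoIntervals a) := fun x hx =>
  (hs x hx).1.continuousAt.continuousWithinAt

/-- The normal form of a Green's function. -/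
structure GreenData (a : Fin 4 → ℝ) (z : ℂ) (h₁ A₁ B₁ h₂ A₂ B₂ : ℝ → ℂ) (W : ℂ) : Prop where
  sol₁ : SolutionData a z h₁ A₁ B₁
  sol₂ : SolutionData a z h₂ A₂ B₂
  bc₁ : B₁ (a 1) = 0
  bc₂ : B₂ (a 3) = 0
  wronskian : ∀ x ∈ Icc (a 1) (a 3), A₁ x * B₂ x - A₂ x * B₁ x = W
  ne_zero : W ≠ 0

/-- At most logarithmic growth makes `h₁` and `h₂` square-integrable, so they have boundary data.
The two conditions at `ξ` form a linear system for `c₁(ξ)`, `c₂(ξ)` whose determinant is, after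
multiplication by `P` and up to sign, the Wronskian `W`. -/
theorem IsGreenFunction.exists_greenData {a : Fin 4 → ℝ} (ha : StrictMono a) {z : ℂ}
    {G : ℝ → ℝ → ℂ} (hG : IsGreenFunction a z G) :
    ∃ h₁ A₁ B₁ h₂ A₂ B₂ W, GreenData a z h₁ A₁ B₁ h₂ A₂ B₂ W ∧
      ∀ x ∈ twoIntervals a, ∀ ξ ∈ twoIntervals a,
        (x ≤ ξ → G x ξ = W⁻¹ * (h₁ x * h₂ ξ)) ∧ (ξ ≤ x → G x ξ = W⁻¹ * (h₂ x * h₁ ξ)) := by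
  have h12 : a 1 < a 2 := ha (by decide)
  have h23 : a 2 < a 3 := ha (by decide)
  obtain ⟨h₁, h₂, c₁, c₂, ⟨s₁, u₁, v₁, b₁, l₁, r₁, e₁⟩, ⟨s₂, u₂, v₂, b₂, l₂, r₂, e₂⟩, hc, hGc⟩ := hG
  have m₁ : MemLp h₁ 2 (mu a) := memLp_mu_of
    (memLp_of_log_growth h12 (s₁.continuousOn.mono subset_union_left) (b₁.log_growth _)
      (l₁.log_growth nhdsWithin_le_nhds))
    (memLp_of_log_growth h23 (s₁.continuousOn.mono subset_union_right)
      (r₁.log_growth nhdsWithin_le_nhds) (e₁.log_growth nhdsWithin_le_nhds))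
  have m₂ : MemLp h₂ 2 (mu a) := memLp_mu_of
    (memLp_of_log_growth h12 (s₂.continuousOn.mono subset_union_left)
      (b₂.log_growth nhdsWithin_le_nhds) (l₂.log_growth nhdsWithin_le_nhds))
    (memLp_of_log_growth h23 (s₂.continuousOn.mono subset_union_right)
      (r₂.log_growth nhdsWithin_le_nhds) (e₂.log_growth _))
  obtain ⟨A₁, B₁, H₁⟩ := s₁.exists_solutionData ha m₁ u₁ v₁
  obtain ⟨A₂, B₂, H₂⟩ := s₂.exists_solutionData ha m₂ u₂ v₂
  set W := A₁ (a 1) * B₂ (a 1) - A₂ (a 1) * B₁ (a 1) with hWdef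
  have hW : ∀ x ∈ Icc (a 1) (a 3), A₁ x * B₂ x - A₂ x * B₁ x = W := fun x hx =>
    H₁.wronskian_eq H₂ hx
  have key : ∀ ξ ∈ twoIntervals a, c₁ ξ * W = h₂ ξ ∧ c₂ ξ * W = h₁ ξ := by
    intro ξ hξ
    obtain ⟨k1, k2⟩ := hc ξ hξ
    rw [(H₁.deriv ξ hξ).deriv, (H₂.deriv ξ hξ).deriv] at k2
    have hP := P_cast_ne_zero ha hξ
    field_simp at k2
    have hw : h₁ ξ * B₂ ξ - h₂ ξ * B₁ ξ = W := by
      rw [← hW ξ (Ioo_subset_Icc_self (twoIntervals_subset ha hξ)), H₁.eq ξ hξ, H₂.eq ξ hξ]; ring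
    rw [← hw]
    constructor
    · linear_combination B₂ ξ * k1 - h₂ ξ * k2
    · linear_combination B₁ ξ * k1 - h₁ ξ * k2
  -- If `W = 0`, then `c₁ W = h₂` forces `h₂ = 0`, against its logarithmic singularity at `a₃`.
  have hW0 : W ≠ 0 := by
    intro h0
    refine l₂.not_eventually_zero (nhdsWithin_mono _ fun x hx => ne_of_lt (mem_Iio.1 hx)) ?_
    filter_upwards [twoIntervals_mem_nhdsLT_mid ha] with x hx
    rw [← (key x hx).1, h0, mul_zero]
  refine ⟨h₁, A₁, B₁, h₂, A₂, B₂, W, ⟨H₁, H₂, ?_, ?_, hW, hW0⟩, fun x hx ξ hξ => ⟨fun h => ?_,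
    fun h => ?_⟩⟩
  · exact H₁.eq_zero_of_boundedAlong ha (twoIntervals_mem_nhdsGT_left ha) (mem_Icc_one ha)
      (nhdsWithin_mono _ fun x hx => ne_of_gt (mem_Ioi.1 hx)) b₁
  · exact H₂.eq_zero_of_boundedAlong ha (twoIntervals_mem_nhdsLT_right ha) (mem_Icc_three ha)
      (nhdsWithin_mono _ fun x hx => ne_of_lt (mem_Iio.1 hx)) e₂
  · rw [(hGc x hx ξ hξ).1 h, ← (key ξ hξ).1]
    field_simp
  · rw [(hGc x hx ξ hξ).2 h, ← (key ξ hξ).2]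
    field_simp

/-! ### Existence of a Green's function for `z = i`. -/

theorem exists_isGreenFunction {a : Fin 4 → ℝ} (ha : StrictMono a) :
    ∃ G : ℝ → ℝ → ℂ, IsGreenFunction a Complex.I G := by
  have h12 : a 1 < a 2 := ha (by decide)
  have h23 : a 2 < a 3 := ha (by decide)
  obtain ⟨h₁, A₁, B₁, H₁, hA₁, hB₁⟩ := exists_solutionData ha Complex.I 1 0
  obtain ⟨h₂, A₂, B₂, H₂, hA₂, hB₂⟩ := exists_solutionData_right ha Complex.I
  have n₁ : ¬ ∀ x ∈ Ioo (a 1) (a 2), h₁ x = 0 := fun h => by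
    have := (H₁.eq_zero_of_eqOn ha h12 subset_union_left h _ (left_mem_Icc.2 h12.le)).1
    simp [hA₁] at this
  have n₂ : ¬ ∀ x ∈ Ioo (a 2) (a 3), h₂ x = 0 := fun h => by
    have := (H₂.eq_zero_of_eqOn ha h23 subset_union_right h _ (right_mem_Icc.2 h23.le)).1
    simp [hA₂] at this
  -- A second zero of `B₁` would equate the energies at the two points and make `h₁` vanish on
  -- `(a₂,a₃)`; the same argument serves `h₂` on `(a₃,a₄)`.
  have B₁2 : B₁ (a 2) ≠ 0 := fun h0 => n₁ fun x hx =>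
    H₁.eq_zero_of_energy_eq ha (mem_Icc_one ha) (mem_Icc_two ha) (by simp [hB₁, h0]) hx (Or.inl hx)
  have B₁3 : B₁ (a 3) ≠ 0 := fun h0 => n₁ fun x hx =>
    H₁.eq_zero_of_energy_eq ha (mem_Icc_one ha) (mem_Icc_three ha) (by simp [hB₁, h0])
      (Ioo_subset_Ioo_right h23.le hx) (Or.inl hx)
  have B₂2 : B₂ (a 2) ≠ 0 := fun h0 => n₂ fun x hx =>
    H₂.eq_zero_of_energy_eq ha (mem_Icc_two ha) (mem_Icc_three ha) (by simp [hB₂, h0]) hx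
      (Or.inr hx)
  have B₂1 : B₂ (a 1) ≠ 0 := fun h0 => n₂ fun x hx =>
    H₂.eq_zero_of_energy_eq ha (mem_Icc_one ha) (mem_Icc_three ha) (by simp [hB₂, h0])
      (Ioo_subset_Ioo_left h12.le hx) (Or.inr hx)
  -- The Wronskian is evaluated at `a₂`, where `A₁ = 1` and `B₁ = 0`.
  have hW : ∀ x ∈ twoIntervals a, h₁ x * B₂ x - h₂ x * B₁ x = B₂ (a 1) := fun x hx => by
    have := H₁.wronskian_eq H₂ (Ioo_subset_Icc_self (twoIntervals_subset ha hx))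
    rw [hA₁, hB₁] at this
    rw [H₁.eq x hx, H₂.eq x hx]
    linear_combination this
  refine ⟨fun x ξ => if x ≤ ξ then (B₂ (a 1))⁻¹ * h₂ ξ * h₁ x else (B₂ (a 1))⁻¹ * h₁ ξ * h₂ x,
    h₁, h₂, fun ξ => (B₂ (a 1))⁻¹ * h₂ ξ, fun ξ => (B₂ (a 1))⁻¹ * h₁ ξ,
    ⟨H₁.isSolution ha, H₁.transmits_uFun ha, H₁.transmits_vFun ha, H₁.boundedAlong_left ha hB₁,
      H₁.logarithmicAlong ha (twoIntervals_mem_nhdsLT_mid ha) (mem_Icc_two ha) B₁2,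
      H₁.logarithmicAlong ha (twoIntervals_mem_nhdsGT_mid ha) (mem_Icc_two ha) B₁2,
      H₁.logarithmicAlong ha (twoIntervals_mem_nhdsLT_right ha) (mem_Icc_three ha) B₁3⟩,
    ⟨H₂.isSolution ha, H₂.transmits_uFun ha, H₂.transmits_vFun ha,
      H₂.logarithmicAlong ha (twoIntervals_mem_nhdsGT_left ha) (mem_Icc_one ha) B₂1,
      H₂.logarithmicAlong ha (twoIntervals_mem_nhdsLT_mid ha) (mem_Icc_two ha) B₂2,
      H₂.logarithmicAlong ha (twoIntervals_mem_nhdsGT_mid ha) (mem_Icc_two ha) B₂2,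
      H₂.boundedAlong_right ha hB₂⟩, fun ξ hξ => ⟨by ring, ?_⟩, fun x _ ξ _ => ⟨fun h => ?_,
        fun h => ?_⟩⟩
  · rw [(H₁.deriv ξ hξ).deriv, (H₂.deriv ξ hξ).deriv]
    have hP := P_cast_ne_zero ha hξ
    field_simp
    linear_combination -hW ξ hξ
  · exact if_pos h
  · rcases h.lt_or_eq with h | rfl
    · exact if_neg (not_le.2 h)
    · exact (if_pos le_rfl).trans (by ring)

/-! ### The Green operator as compact resolvent. -/

section Resolvent

variable {a : Fin 4 → ℝ} {h₁ A₁ B₁ h₂ A₂ B₂ : ℝ → ℂ} {W z : ℂ} {G : ℝ → ℝ → ℂ}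

theorem GreenData.memLp (D : GreenData a z h₁ A₁ B₁ h₂ A₂ B₂ W)
    (hG : ∀ x ∈ twoIntervals a, ∀ ξ ∈ twoIntervals a,
        (x ≤ ξ → G x ξ = W⁻¹ * (h₁ x * h₂ ξ)) ∧ (ξ ≤ x → G x ξ = W⁻¹ * (h₂ x * h₁ ξ))) :
    MemLp (fun p : ℝ × ℝ => G p.1 p.2) 2
      (volume.restrict (Ioo (a 1) (a 3) ×ˢ Ioo (a 1) (a 3))) := by
  rw [Measure.volume_eq_prod, ← Measure.prod_restrict]
  have prod : ∀ f g : ℝ → ℂ, MemLp f 2 (mu a) → MemLp g 2 (mu a) →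
      MemLp (fun p : ℝ × ℝ => f p.1 * g p.2) 2 ((mu a).prod (mu a)) := fun f g hf hg => by
    refine (memLp_two_iff_integrable_sq_norm (hf.1.comp_fst.mul hg.1.comp_snd)).2 ?_
    simp only [Pi.mul_apply, norm_mul, mul_pow]
    exact ((memLp_two_iff_integrable_sq_norm hf.1).1 hf).mul_prod
      ((memLp_two_iff_integrable_sq_norm hg.1).1 hg)
  have hS : MeasurableSet {p : ℝ × ℝ | p.1 ≤ p.2} := measurableSet_le measurable_fst measurable_snd
  refine (((prod h₁ h₂ D.sol₁.memLp D.sol₂.memLp).indicator hS).add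
    ((prod h₂ h₁ D.sol₂.memLp D.sol₁.memLp).indicator hS.compl)).const_mul W⁻¹ |>.ae_eq ?_
  have hae : ∀ᵐ p ∂((mu a).prod (mu a)), p.1 ∈ twoIntervals a ∧ p.2 ∈ twoIntervals a :=
    (Measure.quasiMeasurePreserving_fst.ae (ae_mem_twoIntervals a)).and
      (Measure.quasiMeasurePreserving_snd.ae (ae_mem_twoIntervals a))
  filter_upwards [hae] with p hp
  by_cases h : p.1 ≤ p.2
  · simp [Pi.add_apply, indicator, h, (hG _ hp.1 _ hp.2).1 h]
  · simp [Pi.add_apply, indicator, h, (hG _ hp.1 _ hp.2).2 (not_le.1 h).le]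

/-- The integral splits at `ξ = x` into the two branches of the kernel. The minus sign appears
because the second primitive is based at `a₄`. -/
theorem GreenData.integral_eq (D : GreenData a z h₁ A₁ B₁ h₂ A₂ B₂ W) (ha : StrictMono a)
    (hG : ∀ x ∈ twoIntervals a, ∀ ξ ∈ twoIntervals a,
        (x ≤ ξ → G x ξ = W⁻¹ * (h₁ x * h₂ ξ)) ∧ (ξ ≤ x → G x ξ = W⁻¹ * (h₂ x * h₁ ξ)))
    {f : ℝ → ℂ} (hf : MemLp f 2 (mu a)) {x : ℝ} (hx : x ∈ twoIntervals a) :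
    ∫ ξ in Ioo (a 1) (a 3), G x ξ * f ξ = W⁻¹ *
      (h₂ x * (∫ t in (a 1)..x, h₁ t * f t) - h₁ x * ∫ t in (a 3)..x, h₂ t * f t) := by
  have hxI := twoIntervals_subset ha hx
  have h13 : a 1 ≤ a 3 := ha.monotone (by decide)
  have i₁ := (intervalIntegrable_mul h13 D.sol₁.memLp hf).mono_Icc (mem_Icc_one ha)
    (Ioo_subset_Icc_self hxI)
  have i₂ := (intervalIntegrable_mul h13 D.sol₂.memLp hf).mono_Icc (Ioo_subset_Icc_self hxI)
    (mem_Icc_three ha)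
  have hae := ae_mem_twoIntervals a
  rw [mu, restrict_Ioo_eq_restrict_Ioc] at hae
  have e₁ : ∀ᵐ ξ ∂volume.restrict (uIoc (a 1) x),
      (W⁻¹ * h₂ x) * (h₁ ξ * f ξ) = G x ξ * f ξ := by
    rw [uIoc_of_le hxI.1.le]
    filter_upwards [ae_restrict_of_ae_restrict_of_subset (Ioc_subset_Ioc_right hxI.2.le) hae,
      ae_restrict_mem measurableSet_Ioc] with ξ hξ hξx
    rw [(hG x hx ξ hξ).2 hξx.2]; ring
  have e₂ : ∀ᵐ ξ ∂volume.restrict (uIoc x (a 3)),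
      (W⁻¹ * h₁ x) * (h₂ ξ * f ξ) = G x ξ * f ξ := by
    rw [uIoc_of_le hxI.2.le]
    filter_upwards [ae_restrict_of_ae_restrict_of_subset (Ioc_subset_Ioc_left hxI.1.le) hae,
      ae_restrict_mem measurableSet_Ioc] with ξ hξ hξx
    rw [(hG x hx ξ hξ).1 hξx.1.le]; ring
  rw [restrict_Ioo_eq_restrict_Ioc, ← intervalIntegral.integral_of_le h13,
    ← intervalIntegral.integral_add_adjacent_intervals ((i₁.const_mul _).congr_ae e₁)
      ((i₂.const_mul _).congr_ae e₂),
    ← intervalIntegral.integral_congr_ae_restrict e₁,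
    ← intervalIntegral.integral_congr_ae_restrict e₂, intervalIntegral.integral_const_mul,
    intervalIntegral.integral_const_mul, intervalIntegral.integral_symm x (a 3)]
  ring

theorem LS_eq_zero (ha : StrictMono a) (y : (LS a ha).domain)
    (hy : LS a ha y = Complex.I • (y : H a)) : (y : H a) = 0 := by
  obtain ⟨ψ, hψ, h1, h2⟩ := mem_graph_LS.1 (LinearPMap.mem_graph (LS a ha) y)
  rw [hy] at h2
  have h0 := hψ.eq_zero ha (by
    filter_upwards [h1, h2, Lp.coeFn_smul Complex.I (y : H a)] with x k1 k2 k3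
    rw [← k2, k3, Pi.smul_apply, k1, smul_eq_mul])
  rw [Lp.eq_zero_iff_ae_eq_zero]
  filter_upwards [h1, ae_mem_twoIntervals a] with x k1 k2
  rw [k1, h0 x k2]; rfl

/-- Variation of parameters gives a right inverse. A right inverse of an injective operator is also
a left inverse, and each of the two branches is compact. -/
theorem GreenData.exists_resolvent (D : GreenData a Complex.I h₁ A₁ B₁ h₂ A₂ B₂ W)
    (ha : StrictMono a) :
    ∃ R : H a →L[ℂ] H a, IsResolventAt (LS a ha) Complex.I R ∧ IsCompactOperator R ∧
      ∀ f : H a, R f =ᵐ[mu a] fun x => W⁻¹ *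
        (h₂ x * (∫ t in (a 1)..x, h₁ t * f t) - h₁ x * ∫ t in (a 3)..x, h₂ t * f t) := by
  have h13 : a 1 ≤ a 3 := ha.monotone (by decide)
  obtain ⟨R₁, hR₁, k₁⟩ := exists_compact_mul_primitive h13 D.sol₂.memLp D.sol₁.memLp
    (mem_Icc_one ha)
  obtain ⟨R₂, hR₂, k₂⟩ := exists_compact_mul_primitive h13 D.sol₁.memLp D.sol₂.memLp
    (mem_Icc_three ha)
  have hR : ∀ f : H a, (W⁻¹ • (R₁ - R₂)) f =ᵐ[mu a] fun x => W⁻¹ *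
      (h₂ x * (∫ t in (a 1)..x, h₁ t * f t) - h₁ x * ∫ t in (a 3)..x, h₂ t * f t) := fun f => by
    have e : (W⁻¹ • (R₁ - R₂)) f = W⁻¹ • (R₁ f - R₂ f) := rfl
    rw [e]
    filter_upwards [Lp.coeFn_smul W⁻¹ (R₁ f - R₂ f), Lp.coeFn_sub (R₁ f) (R₂ f), k₁ f, k₂ f]
      with x e1 e2 e3 e4
    rw [e1, Pi.smul_apply, e2, Pi.sub_apply, e3, e4, smul_eq_mul]
  have hright : ∀ f : H a, ∃ hf : (W⁻¹ • (R₁ - R₂)) f ∈ (LS a ha).domain,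
      LS a ha ⟨_, hf⟩ - Complex.I • (W⁻¹ • (R₁ - R₂)) f = f := fun f => by
    obtain ⟨hD, hL⟩ := inDomainLS_green ha D.sol₁ D.sol₂ D.bc₁ D.bc₂ D.wronskian D.ne_zero
      (Lp.memLp f) (fun _ => rfl)
    have hg : ((W⁻¹ • (R₁ - R₂)) f, Complex.I • (W⁻¹ • (R₁ - R₂)) f + f) ∈ (LS a ha).graph := by
      refine mem_graph_LS.2 ⟨_, hD, hR f, ?_⟩
      filter_upwards [Lp.coeFn_add (Complex.I • (W⁻¹ • (R₁ - R₂)) f) f,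
        Lp.coeFn_smul Complex.I ((W⁻¹ • (R₁ - R₂)) f), hL, hR f] with x e1 e2 e3 e4
      rw [e1, Pi.add_apply, e2, Pi.smul_apply, e4, e3, smul_eq_mul]
    obtain ⟨y, hy1, hy2⟩ := (LinearPMap.mem_graph_iff _).1 hg
    dsimp only at hy1 hy2
    rw [← hy1] at hy2 ⊢
    exact ⟨y.2, by rw [Subtype.coe_eta, hy2, add_sub_cancel_left]⟩
  refine ⟨W⁻¹ • (R₁ - R₂), ⟨hright, fun ψ => ?_⟩, (hR₁.sub hR₂).smul W⁻¹, hR⟩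
  obtain ⟨y, hy, he⟩ : ∃ y : (LS a ha).domain,
      (y : H a) = (W⁻¹ • (R₁ - R₂)) (LS a ha ψ - Complex.I • (ψ : H a)) ∧
        LS a ha y - Complex.I • (y : H a) = LS a ha ψ - Complex.I • (ψ : H a) := by
    obtain ⟨hm, he⟩ := hright (LS a ha ψ - Complex.I • (ψ : H a))
    exact ⟨⟨_, hm⟩, rfl, he⟩
  have := LS_eq_zero ha (y - ψ) (by
    rw [LinearPMap.map_sub, eq_add_of_sub_eq he, Submodule.coe_sub, smul_sub]
    abel)
  rw [← hy]
  exact sub_eq_zero.1 this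

end Resolvent

/-- Lets a single operator be represented by every Green's function, although each Green's function
produces its own resolvent. -/
theorem IsResolventAt.unique {E : Type*} [NormedAddCommGroup E] [NormedSpace ℂ E]
    {A : E →ₗ.[ℂ] E} {z : ℂ} {R S : E →L[ℂ] E} (hR : IsResolventAt A z R)
    (hS : IsResolventAt A z S) (f : E) : R f = S f := by
  obtain ⟨hf, he⟩ := hS.1 f
  have h := hR.2 ⟨S f, hf⟩
  dsimp only at h
  rwa [he] at h

end TruncatedHilbert
end

theorem mainTheorem8 (a : Fin 4 → ℝ) (ha : StrictMono a) :
    (∃ G : ℝ → ℝ → ℂ, TruncatedHilbert.IsGreenFunction a Complex.I G) ∧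
    (∀ G : ℝ → ℝ → ℂ, TruncatedHilbert.IsGreenFunction a Complex.I G →
      MemLp (fun p : ℝ × ℝ => G p.1 p.2) 2
        (volume.restrict (Ioo (a 1) (a 3) ×ˢ Ioo (a 1) (a 3)))) ∧
    ∃ R : TruncatedHilbert.H a →L[ℂ] TruncatedHilbert.H a,
      TruncatedHilbert.IsResolventAt (TruncatedHilbert.LS a ha) Complex.I R ∧
      IsCompactOperator R ∧
      ∀ G : ℝ → ℝ → ℂ, TruncatedHilbert.IsGreenFunction a Complex.I G →
        ∀ f : TruncatedHilbert.H a,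
          ∀ᵐ x ∂(volume.restrict (Ioo (a 1) (a 3))),
            R f x = ∫ ξ in Ioo (a 1) (a 3), G x ξ * f ξ := by
  refine ⟨TruncatedHilbert.exists_isGreenFunction ha, fun G hG => ?_, ?_⟩
  · obtain ⟨h₁, A₁, B₁, h₂, A₂, B₂, W, D, hGW⟩ := hG.exists_greenData ha
    exact D.memLp hGW
  · obtain ⟨G₀, hG₀⟩ := TruncatedHilbert.exists_isGreenFunction ha
    obtain ⟨_, _, _, _, _, _, _, D₀, -⟩ := hG₀.exists_greenData ha
    obtain ⟨R, hR, hRc, -⟩ := D₀.exists_resolvent ha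
    refine ⟨R, hR, hRc, fun G hG f => ?_⟩
    obtain ⟨h₁, A₁, B₁, h₂, A₂, B₂, W, D, hGW⟩ := hG.exists_greenData ha
    obtain ⟨S, hS, -, hSf⟩ := D.exists_resolvent ha
    rw [hR.unique hS f]
    filter_upwards [hSf f, TruncatedHilbert.ae_mem_twoIntervals a] with x hx hxm
    rw [hx, D.integral_eq ha hGW (Lp.memLp f) hxm]
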